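/- Let $R$ be a regular ring (commutative, noetherian, with all localizations at prime ideals regular local rings), $G$ a finitely generated free abelian group and $G^\star=\mathrm{Hom}(G,\mathbb{Z})$. A convex cone in $G$ is a finitely generated saturated submonoid $P\subseteq G$ with no nonzero invertible element and with $G/P^{\mathrm{gp}}$ torsion free; its faces are the submonoids $P\setminus\mathfrak p$ with $\mathfrak p$ a prime ideal of $P$ ($\mathfrak p=\emptyset$ allowed), and $\check P=\{\sigma\in G^\star:\sigma(x)\ge 0\ \text{for all}\ x\in P\}$. Let $\triangle$ be a fan in $G$, that is, a nonempty (possibly infinite) collection of convex cones in $G$ that contains all faces of its members and in which the intersection of any two members is a face of both. Let $X$ be the toric scheme over $R$ obtained by gluing the affine schemes $U_P=\operatorname{Spec} R[\check P]$ $(P\in\triangle)$ along the open subschemes $U_{P\cap Q}\subseteq U_P,U_Q$, and let $\mathscr M$ be the (Zariski) log structure on $X$ obtained by gluing the log structures on the $U_P$ generated by $\check P\to R[\check P]$. Then $(X,\mathscr M)$ is logarithmically regular, i.e. for every $x\in X$, if $I(x,\mathscr M)$ denotes the ideal of $\mathcal O_{X,x}$ generated by the image of $\mathscr M_x\setminus\mathcal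 O_{X,x}^\ast$, then 1. $\mathcal O_{X,x}/I(x,\mathscr M)$ is a regular local ring, and 2. $\dim\mathcal O_{X,x}=\dim\bigl(\mathcal O_{X,x}/I(x,\mathscr M)\bigr)+\operatorname{rank}\bigl(\mathscr M_x^{\mathrm{gp}}/\mathcal O_{X,x}^\ast\bigr)$. -/

import Mathlib

universe u v

noncomputable section

open CategoryTheory AlgebraicGeometry TopologicalSpace Opposite Limits

/-- The category of commutative monoids is cocomplete: the colimit is the abelianization of the
colimit in the category of monoids. -/
instance CommMonCat.hasColimitsOfSize_self : HasColimitsOfSize.{u, u} CommMonCat.{u} where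
  has_colimits_of_shape J _ :=
    { has_colimit := fun F => by
        let C := colimit (F ⋙ forget₂ CommMonCat MonCat)
        let c : Con C := conGen fun a b => ∃ x y : C, a = x * y ∧ b = y * x
        let _ : CommMonoid c.Quotient :=
          { (inferInstance : Monoid c.Quotient) with
            mul_comm := fun a b => Con.induction_on₂ a b fun x y =>
              (Con.eq c).2 (ConGen.Rel.of _ _ ⟨x, y, rfl, rfl⟩) }
        let ι (j : J) : F.obj j →* c.Quotient :=
          c.mk'.comp (colimit.ι (F ⋙ forget₂ CommMonCat MonCat) j).hom
        let s : Cocone F :=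
          { pt := CommMonCat.of c.Quotient
            ι :=
              { app := fun j => CommMonCat.ofHom (ι j)
                naturality := fun i j f => by
                  ext x
                  have := ConcreteCategory.congr_hom
                    (colimit.w (F ⋙ forget₂ CommMonCat MonCat) f) x
                  exact congrArg c.mk' this } }
        refine ⟨s, ?_⟩
        let d (t : Cocone F) : C ⟶ MonCat.of t.pt :=
          colimit.desc (F ⋙ forget₂ CommMonCat MonCat) ((forget₂ CommMonCat MonCat).mapCocone t)
        have hd (t : Cocone F) : c ≤ Con.ker (d t).hom := by
          refine Con.conGen_le.2 ?_
          rintro _ _ ⟨x, y, rfl, rfl⟩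
          simp only [Con.ker_rel, map_mul]
          exact mul_comm (G := t.pt) _ _
        exact
          { desc := fun t => CommMonCat.ofHom (c.lift (d t).hom (hd t))
            fac := fun t j => by
              ext x
              exact ConcreteCategory.congr_hom (colimit.ι_desc
                ((forget₂ CommMonCat MonCat).mapCocone t) j) x
            uniq := fun t m hm => by
              ext x
              have : MonCat.ofHom (m.hom.comp c.mk') = d t := by
                refine colimit.hom_ext fun j => ?_
                ext x
                refine (ConcreteCategory.congr_hom (hm j) x).trans ?_
                exact (ConcreteCategory.congr_hom (colimit.ι_desc
                  ((forget₂ CommMonCat MonCat).mapCocone t) j) x).symm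
              exact ConcreteCategory.congr_hom this x } }

section LogPushout

variable {A B M N : Type*} [CommRing A] [CommRing B] [CommMonoid M] [CommMonoid N]

/-- For `α : M →* A` with `A` a ring, the pushout of `Aˣ ← α⁻¹(Aˣ) → M` in commutative monoids is the
quotient of `Aˣ × M` by this congruence. -/
def logCon (α : M →* A) : Con (Aˣ × M) where
  r x y := ∃ a b : M, IsUnit (α a) ∧ IsUnit (α b) ∧ x.2 * a = y.2 * b ∧ x.1 * α b = y.1 * α a
  iseqv :=
    { refl := fun x => ⟨1, 1, by simp, by simp, rfl, rfl⟩
      symm := fun ⟨a, b, ha, hb, h, h'⟩ => ⟨b, a, hb, ha, h.symm, h'.symm⟩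
      trans := fun {x y z} ⟨a, b, ha, hb, h, h'⟩ ⟨c, d, hc, hd, k, k'⟩ => by
        refine ⟨a * c, b * d, by simpa using ⟨ha, hc⟩, by simpa using ⟨hb, hd⟩, ?_, ?_⟩
        · rw [← mul_assoc, h, mul_right_comm, k, mul_right_comm, mul_assoc]
        · rw [map_mul, map_mul, ← mul_assoc, h', mul_right_comm, k']; ring }
  mul' := fun {x y z w} ⟨a, b, ha, hb, h, h'⟩ ⟨c, d, hc, hd, k, k'⟩ => by
    refine ⟨a * c, b * d, by simpa using ⟨ha, hc⟩, by simpa using ⟨hb, hd⟩, ?_, ?_⟩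
    · rw [Prod.snd_mul, Prod.snd_mul, mul_mul_mul_comm, h, k, mul_mul_mul_comm]
    · rw [Prod.fst_mul, Prod.fst_mul, Units.val_mul, Units.val_mul, map_mul, map_mul,
        mul_mul_mul_comm, h', k', mul_mul_mul_comm]

/-- The pushout of `Aˣ ← α⁻¹(Aˣ) → M` in the category of commutative monoids. -/
abbrev LogPushout (α : M →* A) := (logCon α).Quotient

namespace LogPushout

/-- The class of `(u, m)` in the pushout. -/
def mk (α : M →* A) : Aˣ × M →* LogPushout α := (logCon α).mk'

lemma mk_eq_mk {α : M →* A} {x y : Aˣ × M} : mk α x = mk α y ↔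
    ∃ a b : M, IsUnit (α a) ∧ IsUnit (α b) ∧ x.2 * a = y.2 * b ∧ x.1 * α b = y.1 * α a :=
  Con.eq (logCon α)

lemma mk_surjective (α : M →* A) : Function.Surjective (mk α) := Con.mk'_surjective

/-- The homomorphism `(u, m) ↦ u * α m`. -/
def toRing (α : M →* A) : LogPushout α →* A :=
  (logCon α).lift ((Units.coeHom A).coprod α) <| by
    rintro x y ⟨a, b, ha, hb, h, h'⟩
    have h2 := congrArg α h
    rw [map_mul, map_mul] at h2
    refine (ha.mul hb).mul_right_cancel ?_
    simp only [MonoidHom.coprod_apply, Units.coeHom_apply]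
    linear_combination (α x.2 * α a) * h' + (y.1 * α a : A) * h2

/-- Functoriality of the pushout. -/
def map (α : M →* A) (β : N →* B) (f : A →+* B) (g : M →* N)
    (h : ∀ m, β (g m) = f (α m)) : LogPushout α →* LogPushout β :=
  (logCon α).lift ((mk β).comp ((Units.map (f : A →* B)).prodMap g)) <| by
    rintro x y ⟨a, b, ha, hb, h', h''⟩
    refine (Con.eq _).2 ⟨g a, g b, ?_, ?_, ?_, ?_⟩
    · rw [h]; exact ha.map f
    · rw [h]; exact hb.map f
    · simpa using congrArg g h'
    · simpa [h] using congrArg f h''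

end LogPushout
end LogPushout

/-- A pre-log structure on a scheme, for the Zariski topology: a presheaf of commutative monoids with
a homomorphism to the multiplicative monoid of the structure sheaf. -/
structure PreLogStructure (X : Scheme.{u}) where
  monoid : TopCat.Presheaf CommMonCat.{u} X
  α : monoid ⟶ X.presheaf ⋙ forget₂ CommRingCat CommMonCat

namespace PreLogStructure

variable {X : Scheme.{u}} (L : PreLogStructure X)

/-- The homomorphism `α` on sections. -/
def sectionsHom (U : X.Opens) : L.monoid.obj (op U) →* Γ(X, U) := (L.α.app (op U)).hom

lemma sectionsHom_map {U V : X.Opens} (h : V ≤ U) (s : L.monoid.obj (op U)) :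
    L.sectionsHom V (L.monoid.map (homOfLE h).op s) =
      X.presheaf.map (homOfLE h).op (L.sectionsHom U s) :=
  ConcreteCategory.congr_hom (L.α.naturality (homOfLE h).op) s

/-- The homomorphism `α` on stalks. -/
def stalkHom (x : X) : L.monoid.stalk x →* X.presheaf.stalk x :=
  (colimit.desc ((OpenNhds.inclusion x).op ⋙ L.monoid)
    { pt := (forget₂ CommRingCat CommMonCat).obj (X.presheaf.stalk x)
      ι :=
        { app := fun U => L.α.app (op U.unop.1) ≫
            (forget₂ CommRingCat CommMonCat).map (X.presheaf.germ U.unop.1 x U.unop.2)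
          naturality := fun U V i => by
            refine CommMonCat.hom_ext (MonoidHom.ext fun s => ?_)
            have h := ConcreteCategory.congr_hom
              (L.α.naturality ((OpenNhds.inclusion x).op.map i)) s
            have h' := ConcreteCategory.congr_hom
              (X.presheaf.germ_res ((OpenNhds.inclusion x).map i.unop) x V.unop.2)
              (L.sectionsHom U.unop.1 s)
            exact (congrArg (X.presheaf.germ V.unop.1 x V.unop.2) h).trans h' } }).hom

lemma stalkHom_germ (x : X) (U : X.Opens) (hx : x ∈ U) (s : L.monoid.obj (op U)) :
    L.stalkHom x (L.monoid.germ U x hx s) = X.presheaf.germ U x hx (L.sectionsHom U s) :=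
  ConcreteCategory.congr_hom
    (colimit.ι_desc (F := (OpenNhds.inclusion x).op ⋙ L.monoid) _ (op ⟨U, hx⟩)) s

/-- The presheaf pushout of `𝒪ˣ ← α⁻¹(𝒪ˣ) → monoid`, with its homomorphism to `𝒪`. -/
def pushout : PreLogStructure X where
  monoid :=
    { obj := fun U => CommMonCat.of (LogPushout (L.sectionsHom U.unop))
      map := fun {U V} i => CommMonCat.ofHom
        (LogPushout.map _ _ (X.presheaf.map i).hom (L.monoid.map i).hom
          fun m => ConcreteCategory.congr_hom (L.α.naturality i) m)
      map_id := fun U => by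
        refine CommMonCat.hom_ext (Con.hom_ext (MonoidHom.ext fun m => ?_))
        refine congrArg (LogPushout.mk (L.sectionsHom _)) (Prod.ext (Units.ext ?_) ?_)
        · exact ConcreteCategory.congr_hom (X.presheaf.map_id U) _
        · exact ConcreteCategory.congr_hom (L.monoid.map_id U) _
      map_comp := fun i j => by
        refine CommMonCat.hom_ext (Con.hom_ext (MonoidHom.ext fun m => ?_))
        refine congrArg (LogPushout.mk (L.sectionsHom _)) (Prod.ext (Units.ext ?_) ?_)
        · exact ConcreteCategory.congr_hom (X.presheaf.map_comp i j) _
        · exact ConcreteCategory.congr_hom (L.monoid.map_comp i j) _ }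
  α :=
    { app := fun U => CommMonCat.ofHom (LogPushout.toRing (L.sectionsHom U.unop))
      naturality := fun U V i => by
        refine CommMonCat.hom_ext (Con.hom_ext (MonoidHom.ext fun m => ?_))
        have h := ConcreteCategory.congr_hom (L.α.naturality i) m.2
        have h' : X.presheaf.map i (m.1 * L.sectionsHom U.unop m.2) =
          X.presheaf.map i m.1 * X.presheaf.map i (L.sectionsHom U.unop m.2) := map_mul _ _ _
        refine Eq.trans ?_ h'.symm
        exact congrArg (X.presheaf.map i m.1 * ·) h }

end PreLogStructure

/-- A log structure on a scheme, for the Zariski topology: a sheaf of commutative monoids with a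
homomorphism `α` to the structure sheaf such that `α⁻¹(𝒪ˣ) → 𝒪ˣ` is an isomorphism. -/
structure LogStructure (X : Scheme.{u}) extends PreLogStructure X where
  isSheaf : monoid.IsSheaf
  existsUnique_of_isUnit (U : X.Opens) (f : Γ(X, U)) (hf : IsUnit f) :
    ∃! s : monoid.obj (op U), toPreLogStructure.sectionsHom U s = f

namespace PreLogStructure

variable {X : Scheme.{u}} (L : PreLogStructure X)

lemma isSheaf_multiplicative (X : Scheme.{u}) : Presheaf.IsSheaf (Opens.grothendieckTopology X)
    (X.presheaf ⋙ forget₂ CommRingCat CommMonCat) :=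
  GrothendieckTopology.HasSheafCompose.isSheaf _ X.sheaf.property

/-- The log structure associated with a pre-log structure: the sheafification of the pushout of
`𝒪ˣ ← α⁻¹(𝒪ˣ) → monoid`. -/
def associated : LogStructure X where
  monoid := sheafify (Opens.grothendieckTopology X) L.pushout.monoid
  α := sheafifyLift (Opens.grothendieckTopology X) L.pushout.α (isSheaf_multiplicative X)
  isSheaf := ((presheafToSheaf (Opens.grothendieckTopology X) CommMonCat).obj L.pushout.monoid).2
  existsUnique_of_isUnit U f hf := by
    let J := Opens.grothendieckTopology X
    let η := toSheafify J L.pushout.monoid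
    let a := sheafifyLift J L.pushout.α (isSheaf_multiplicative X)
    have hη (V : X.Opens) (q : L.pushout.monoid.obj (op V)) :
        a.app (op V) (η.app (op V) q) = L.pushout.α.app (op V) q := by
      have := congrArg (fun t => t.app (op V)) (toSheafify_sheafifyLift J L.pushout.α
        (isSheaf_multiplicative X))
      exact ConcreteCategory.congr_hom this q
    have hfst (V : X.Opens) (u : Γ(X, V)ˣ) (p : L.monoid.obj (op V)) :
        L.pushout.α.app (op V) (LogPushout.mk (L.sectionsHom V) (u, p)) =
          (u : Γ(X, V)) * L.sectionsHom V p := rfl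
    let e : L.pushout.monoid.obj (op U) := LogPushout.mk (L.sectionsHom U) (hf.unit, 1)
    refine ⟨η.app (op U) e, ?_, fun s hs => ?_⟩
    · refine (hη U e).trans ((hfst U _ _).trans ?_)
      rw [map_one, mul_one, IsUnit.unit_spec]
    · have hsh := (isSheaf_iff_isSheaf_of_type J _).1 (GrothendieckTopology.HasSheafCompose.isSheaf
        (J := J) (F := forget CommMonCat) _
        ((presheafToSheaf J CommMonCat).obj L.pushout.monoid).2)
      refine (hsh.isSeparated _ (Presheaf.imageSieve_mem J η s)).ext ?_
      rintro V i ⟨q, hq⟩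
      obtain ⟨⟨v, p⟩, rfl⟩ := LogPushout.mk_surjective _ q
      have hV : (v : Γ(X, V)) * L.sectionsHom V p = X.presheaf.map i.op f := by
        have h1 := ConcreteCategory.congr_hom (a.naturality i.op) s
        exact (hfst V v p).symm.trans ((hη V _).symm.trans ((congrArg (a.app (op V)) hq).trans
          (h1.trans (congrArg (X.presheaf.map i.op) hs))))
      have hp : IsUnit (L.sectionsHom V p) := by
        refine isUnit_of_mul_isUnit_right (x := (v : Γ(X, V))) ?_
        rw [hV]
        exact hf.map (X.presheaf.map i.op).hom
      refine hq.symm.trans (Eq.trans ?_ (ConcreteCategory.congr_hom (η.naturality i.op) e))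
      refine congrArg (η.app (op V)) (LogPushout.mk_eq_mk.2 ⟨1, p, by simp, hp, ?_, ?_⟩)
      · exact (mul_one _).trans ((one_mul _).symm.trans
          (congrArg (· * p) (map_one (L.monoid.map i.op).hom).symm))
      · refine hV.trans ?_
        rw [map_one, mul_one]
        rfl

end PreLogStructure

namespace LogStructure

variable {X : Scheme.{u}} (L : LogStructure X)

/-- The ideal `I(x, M)` of `𝒪_{X,x}` generated by the image of `M_x - 𝒪_{X,x}ˣ`, where `𝒪_{X,x}ˣ` is
identified with the submonoid `α⁻¹(𝒪_{X,x}ˣ)` of `M_x`. -/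
def logIdeal (x : X) : Ideal (X.presheaf.stalk x) :=
  Ideal.span {f | ∃ s : L.monoid.stalk x, ¬ IsUnit (L.stalkHom x s) ∧ L.stalkHom x s = f}

/-- The image of `𝒪_{X,x}ˣ ≅ α⁻¹(𝒪_{X,x}ˣ) ⊆ M_x` in the Grothendieck group of `M_x`. -/
def unitSubgroup (x : X) : Subgroup (Algebra.GrothendieckGroup (L.monoid.stalk x)) :=
  Subgroup.closure (Algebra.GrothendieckGroup.of '' {s | IsUnit (L.stalkHom x s)})

/-- The rank of the abelian group `M_xᵍᵖ / 𝒪_{X,x}ˣ` (equal to `⊤` if it is infinite). -/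
def logRank (x : X) : ℕ∞ :=
  Cardinal.toENat (Module.rank ℤ
    (Additive (Algebra.GrothendieckGroup (L.monoid.stalk x) ⧸ L.unitSubgroup x)))

/-- Logarithmic regularity at a point: `𝒪_{X,x} / I(x, M)` is a regular local ring and
`dim 𝒪_{X,x} = dim (𝒪_{X,x} / I(x, M)) + rank (M_xᵍᵖ / 𝒪_{X,x}ˣ)`. -/
structure IsLogRegularAt (x : X) : Prop where
  isRegularLocalRing : IsRegularLocalRing (X.presheaf.stalk x ⧸ L.logIdeal x)
  ringKrullDim_eq : ringKrullDim (X.presheaf.stalk x) =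
    ringKrullDim (X.presheaf.stalk x ⧸ L.logIdeal x) + (L.logRank x : WithBot ℕ∞)

/-- Logarithmic regularity at all points. -/
def IsLogRegular : Prop := ∀ x : X, L.IsLogRegularAt x

end LogStructure
namespace Toric

section Cones

variable {G : Type v} [AddCommGroup G]

/-- A convex cone in `G`: a finitely generated saturated submonoid `P` without nonzero units such that
`G / Pᵍᵖ` is torsion free. -/
structure IsConvexCone (P : AddSubmonoid G) : Prop where
  fg : P.FG
  saturated : ∀ x ∈ AddSubgroup.closure (P : Set G), ∀ n : ℕ, n ≠ 0 → n • x ∈ P → x ∈ P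
  sharp : ∀ x ∈ P, -x ∈ P → x = 0
  torsionFree : IsAddTorsionFree (G ⧸ AddSubgroup.closure (P : Set G))

/-- `𝔭` is a prime ideal of the monoid `P` (the empty set is allowed): an ideal whose complement in `P`
is a submonoid. -/
structure IsPrimeIdeal (P : AddSubmonoid G) (𝔭 : Set G) : Prop where
  subset : 𝔭 ⊆ P
  add_mem : ∀ x ∈ P, ∀ y ∈ 𝔭, x + y ∈ 𝔭
  compl : ∃ F : AddSubmonoid G, (F : Set G) = (P : Set G) \ 𝔭

/-- `F` is the complement in `P` of a prime ideal of `P`. -/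
def IsFace (P F : AddSubmonoid G) : Prop :=
  ∃ 𝔭, IsPrimeIdeal P 𝔭 ∧ (F : Set G) = (P : Set G) \ 𝔭

lemma IsFace.le {P F : AddSubmonoid G} (h : IsFace P F) : F ≤ P := by
  obtain ⟨𝔭, -, h⟩ := h
  intro x hx
  exact (h.le hx).1

lemma IsFace.mem_of_add_mem {P F : AddSubmonoid G} (h : IsFace P F) {x y : G}
    (hx : x ∈ P) (hy : y ∈ P) (hxy : x + y ∈ F) : y ∈ F := by
  obtain ⟨𝔭, hp, h⟩ := h
  by_contra hyF
  have : y ∈ 𝔭 := by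
    by_contra h2
    exact hyF (h.ge ⟨hy, h2⟩)
  exact (h.le hxy).2 (hp.add_mem x hx y this)

variable (G) in
/-- A fan in `G`: a nonempty collection of convex cones, closed under passing to faces, such that the
intersection of any two of them is a face of both. -/
structure Fan where
  cones : Set (AddSubmonoid G)
  nonempty : cones.Nonempty
  isConvexCone : ∀ P ∈ cones, IsConvexCone P
  face_mem : ∀ P ∈ cones, ∀ F, IsFace P F → F ∈ cones
  inter_face : ∀ P ∈ cones, ∀ Q ∈ cones, IsFace P (P ⊓ Q) ∧ IsFace Q (P ⊓ Q)

/-- The dual of `P`: the monoid of homomorphisms `G → ℤ` that are nonnegative on `P`. -/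
def dual (P : AddSubmonoid G) : AddSubmonoid (Module.Dual ℤ G) where
  carrier := {σ | ∀ x ∈ P, 0 ≤ σ x}
  zero_mem' := fun _ _ => le_rfl
  add_mem' := fun ha hb x hx => add_nonneg (ha x hx) (hb x hx)

lemma dual_anti {P Q : AddSubmonoid G} (h : P ≤ Q) : dual Q ≤ dual P :=
  fun _ hσ x hx => hσ x (h hx)

end Cones

section Separation

/-- Finitely many elements of an abelian group are positive for some rational functional unless the
negative of one of them is in the submonoid they generate. -/
lemma exists_pos_hom (n : ℕ) : ∀ {A : Type v} [AddCommGroup A] (l : List A), l.length = n →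
    (∀ x ∈ l, -x ∉ AddSubmonoid.closure {y | y ∈ l}) → ∃ τ : A →+ ℚ, ∀ x ∈ l, 0 < τ x := by
  induction n with
  | zero =>
    intro A _ l hl _
    exact ⟨0, by simp [List.length_eq_zero_iff.1 hl]⟩
  | succ n ih =>
    intro A _ l hl h
    obtain ⟨a, l, rfl⟩ := List.exists_cons_of_length_eq_add_one hl
    have hn : l.length = n := by simpa using hl
    have hmono : AddSubmonoid.closure {y | y ∈ l} ≤ AddSubmonoid.closure {y | y ∈ a :: l} :=
      AddSubmonoid.closure_mono fun y hy => List.mem_cons_of_mem _ hy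
    have ha : a ∈ AddSubmonoid.closure {y | y ∈ a :: l} :=
      AddSubmonoid.subset_closure List.mem_cons_self
    obtain ⟨τ₀, h₀⟩ := ih l hn fun x hx hx' => h x (List.mem_cons_of_mem _ hx) (hmono hx')
    have h₀' : ∀ y ∈ AddSubmonoid.closure {y | y ∈ l}, 0 ≤ τ₀ y := fun y hy => by
      induction hy using AddSubmonoid.closure_induction with
      | mem y hy => exact (h₀ y hy).le
      | zero => simp
      | add x y _ _ hx hy => rw [map_add]; exact add_nonneg hx hy
    let π := QuotientAddGroup.mk' (AddSubgroup.zmultiples a)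
    by_cases hc : ∀ x ∈ l.map π, -x ∉ AddSubmonoid.closure {y | y ∈ l.map π}
    · obtain ⟨τ', h'⟩ := ih (l.map π) (by simpa using hn) hc
      have htor : ∀ n : ℤ, n • a = 0 → n = 0 := by
        suffices ∀ n : ℕ, n • a = 0 → n = 0 by
          intro n hn
          obtain ⟨m, rfl | rfl⟩ := n.eq_nat_or_neg
          · simpa using this m (by simpa using hn)
          · simpa using this m (by simpa using hn)
        intro n hn
        by_contra hne
        obtain ⟨m, rfl⟩ := Nat.exists_eq_succ_of_ne_zero hne
        refine h a List.mem_cons_self ?_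
        have : -a = m • a := by
          rw [succ_nsmul] at hn
          exact (eq_neg_of_add_eq_zero_left hn).symm
        rw [this]
        exact nsmul_mem ha m
      obtain ⟨φ, hφ⟩ := (Module.Baer.of_divisible ℚ).extension_property_addMonoidHom
        (zmultiplesHom A a) (by
          rw [injective_iff_map_eq_zero]
          intro n hn
          exact htor n (by simpa using hn)) (Int.castAddHom ℚ)
      have hφa : φ a = 1 := by simpa using DFunLike.congr_fun hφ 1
      have : ∀ l : List A, (∀ x ∈ l.map π, 0 < τ' x) →
          ∃ N : ℕ, ∀ x ∈ l, 0 < N * τ' (π x) + φ x := by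
        intro l hl
        induction l with
        | nil => exact ⟨0, by simp⟩
        | cons x l ih =>
          obtain ⟨N, hN⟩ := ih fun y hy => hl y (by
            rw [List.map_cons]; exact List.mem_cons_of_mem _ hy)
          obtain ⟨M, hM⟩ := exists_lt_nsmul (hl (π x) (by simp)) (-φ x)
          refine ⟨N + M, fun y hy => ?_⟩
          have hpos : 0 < τ' (π y) := hl _ (List.mem_map_of_mem hy)
          push_cast
          rcases List.mem_cons.1 hy with rfl | hy
          · rw [nsmul_eq_mul] at hM
            have : 0 ≤ (N : ℚ) * τ' (π y) := by positivity
            linarith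
          · have := hN y hy
            have : 0 ≤ (M : ℚ) * τ' (π y) := by positivity
            linarith
      obtain ⟨N, hN⟩ := this l h'
      refine ⟨N • τ'.comp π + φ, fun x hx => ?_⟩
      rcases List.mem_cons.1 hx with rfl | hx
      · have : π x = 0 := (QuotientAddGroup.eq_zero_iff x).2 (AddSubgroup.mem_zmultiples x)
        simp [this, hφa]
      · simpa using hN x hx
    · push Not at hc
      obtain ⟨x, hx, hx'⟩ := hc
      obtain ⟨x, hxl, rfl⟩ := List.mem_map.1 hx
      have : {y | y ∈ l.map π} = π '' {y | y ∈ l} := by ext; simp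
      rw [this, ← AddMonoidHom.map_mclosure] at hx'
      obtain ⟨y, hy, hyx⟩ := hx'
      have hk : x + y ∈ AddSubgroup.zmultiples a := by
        rw [← QuotientAddGroup.eq_zero_iff]
        change π (x + y) = 0
        rw [map_add, hyx, add_neg_cancel]
      obtain ⟨k, hk⟩ := AddSubgroup.mem_zmultiples_iff.1 hk
      refine ⟨τ₀, fun z hz => ?_⟩
      rcases List.mem_cons.1 hz with rfl | hz
      · have hpos : 0 < k * τ₀ z := by
          have := congrArg τ₀ hk
          rw [map_zsmul, map_add, zsmul_eq_mul] at this
          rw [this]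
          exact add_pos_of_pos_of_nonneg (h₀ x hxl) (h₀' y hy)
        have hk0 : 0 < k := by
          by_contra hk0
          obtain ⟨m, hm⟩ := Int.eq_ofNat_of_zero_le (a := -k) (by omega)
          refine h x (List.mem_cons_of_mem _ hxl) ?_
          have : -x = y + m • z := by
            rw [← natCast_zsmul, ← hm, neg_smul, hk]; abel
          rw [this]
          exact add_mem (hmono hy) (nsmul_mem ha m)
        exact (pos_iff_pos_of_mul_pos hpos).1 (by exact_mod_cast hk0)
      · exact h₀ z hz


variable {G : Type v} [AddCommGroup G]

/-- `σ` is nonnegative on `P` and vanishes on `P` exactly at the elements of `F`. -/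
structure CutsOut (P F : AddSubmonoid G) (σ : Module.Dual ℤ G) : Prop where
  nonneg : σ ∈ dual P
  eq_zero_iff : ∀ x ∈ P, σ x = 0 ↔ x ∈ F

lemma IsFace.exists_cutsOut [Module.Finite ℤ G] {P F : AddSubmonoid G} (hP : P.FG) (h : IsFace P F) :
    ∃ σ, CutsOut P F σ := by
  classical
  obtain ⟨S, rfl⟩ := hP
  set P := AddSubmonoid.closure (S : Set G)
  let H := AddSubgroup.closure (F : Set G)
  let π := QuotientAddGroup.mk' H
  let T := S.filter (· ∉ F)
  have hT : ∀ x ∈ T, x ∈ P := fun x hx =>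
    AddSubmonoid.subset_closure (Finset.mem_coe.2 (Finset.mem_filter.1 hx).1)
  have hH : ∀ x ∈ H, ∃ f ∈ F, f + x ∈ F := fun x hx => by
    induction hx using AddSubgroup.closure_induction with
    | mem x hx => exact ⟨0, zero_mem F, by simpa using hx⟩
    | zero => exact ⟨0, zero_mem F, by simp⟩
    | add x y _ _ hx hy =>
      obtain ⟨f, hf, hfx⟩ := hx
      obtain ⟨g, hg, hgy⟩ := hy
      exact ⟨f + g, add_mem hf hg, by simpa [add_add_add_comm] using add_mem hfx hgy⟩
    | neg x _ hx =>
      obtain ⟨f, hf, hfx⟩ := hx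
      exact ⟨f + x, hfx, by simpa using hf⟩
  obtain ⟨τ, hτ⟩ := exists_pos_hom _ (T.toList.map π) rfl (by
    intro x hx hx'
    obtain ⟨x, hxT, rfl⟩ := List.mem_map.1 hx
    have hxT : x ∈ T := by simpa using hxT
    have : {y | y ∈ T.toList.map π} = π '' (T : Set G) := by ext; simp
    rw [this, ← AddMonoidHom.map_mclosure] at hx'
    obtain ⟨y, hy, hyx⟩ := hx'
    have hyP : y ∈ P := (AddSubmonoid.closure_le.2 hT) hy
    have hk : y + x ∈ H := by
      rw [← QuotientAddGroup.eq_zero_iff]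
      change π (y + x) = 0
      rw [map_add, hyx, neg_add_cancel]
    obtain ⟨f, hf, hfx⟩ := hH _ hk
    refine (Finset.mem_filter.1 hxT).2 (h.mem_of_add_mem (x := f + y) (add_mem (h.le hf) hyP)
      (hT x hxT) ?_)
    rwa [add_assoc])
  obtain ⟨B, hB⟩ := Module.Finite.fg_top (R := ℤ) (M := G)
  obtain ⟨b, hb⟩ := IsLocalization.exist_integer_multiples_of_finset (nonZeroDivisors ℤ)
    (B.image fun x => τ (π x))
  have hb0 : (b : ℤ) ≠ 0 := nonZeroDivisors.coe_ne_zero b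
  have hint : ∀ x : G, ∃ m : ℤ, (m : ℚ) = (b : ℤ) * τ (π x) := fun x => by
    have hx : x ∈ Submodule.span ℤ (B : Set G) := hB ▸ Submodule.mem_top
    induction hx using Submodule.span_induction with
    | mem x hx =>
      obtain ⟨m, hm⟩ := hb _ (Finset.mem_image_of_mem _ hx)
      exact ⟨m, by simpa using hm⟩
    | zero => exact ⟨0, by simp⟩
    | add x y _ _ hx hy =>
      obtain ⟨m, hm⟩ := hx
      obtain ⟨n, hn⟩ := hy
      exact ⟨m + n, by push_cast; rw [hm, hn, map_add, map_add, mul_add]⟩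
    | smul k x _ hx =>
      obtain ⟨m, hm⟩ := hx
      exact ⟨k * m, by push_cast; rw [hm, map_zsmul, map_zsmul, zsmul_eq_mul]; ring⟩
  choose ρ hρ using hint
  let σ : Module.Dual ℤ G := (AddMonoidHom.mk' (fun x => (b : ℤ) * ρ x) fun x y => by
    rw [← Int.cast_inj (α := ℚ)]
    push_cast
    rw [hρ, hρ, hρ, map_add, map_add]
    ring).toIntLinearMap
  have hσ (x : G) : (σ x : ℚ) = (b : ℤ) ^ 2 * τ (π x) := by
    change (((b : ℤ) * ρ x : ℤ) : ℚ) = _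
    push_cast
    rw [hρ]
    ring
  have hb2 : (0 : ℚ) < (b : ℤ) ^ 2 := by positivity
  have hF : ∀ x ∈ F, σ x = 0 := fun x hx => by
    have : π x = 0 := (QuotientAddGroup.eq_zero_iff x).2 (AddSubgroup.subset_closure hx)
    have h0 := hσ x
    rw [this, map_zero, mul_zero] at h0
    exact_mod_cast h0
  have hS : ∀ x ∈ S, x ∉ F → 0 < σ x := fun x hx hxF => by
    have : 0 < τ (π x) := hτ _ (List.mem_map_of_mem (by simp [T, hx, hxF]))
    have : (0 : ℚ) < σ x := by rw [hσ]; positivity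
    exact_mod_cast this
  have key : ∀ x ∈ P, 0 ≤ σ x ∧ (σ x = 0 → x ∈ F) := fun x hx => by
    induction hx using AddSubmonoid.closure_induction with
    | mem x hx =>
      by_cases hxF : x ∈ F
      · exact ⟨(hF x hxF).ge, fun _ => hxF⟩
      · exact ⟨(hS x hx hxF).le, fun h0 => absurd h0 (hS x hx hxF).ne'⟩
    | zero => exact ⟨by simp, fun _ => zero_mem F⟩
    | add x y _ _ hx hy =>
      rw [map_add]
      exact ⟨add_nonneg hx.1 hy.1, fun h0 => add_mem (hx.2 (by linarith [hx.1, hy.1]))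
        (hy.2 (by linarith [hx.1, hy.1]))⟩
  exact ⟨σ, fun x hx => (key x hx).1, fun x hx => ⟨(key x hx).2, hF x⟩⟩

namespace CutsOut

variable {P F : AddSubmonoid G} {σ : Module.Dual ℤ G}

lemma neg_mem (h : CutsOut P F σ) (hF : F ≤ P) : -σ ∈ dual F := fun x hx => by
  simp [(h.eq_zero_iff x (hF hx)).2 hx]

lemma exists_add_mem (h : CutsOut P F σ) (hP : P.FG) (τ : Module.Dual ℤ G) (hτ : τ ∈ dual F) :
    ∃ n : ℕ, ∀ m ≥ n, τ + m • σ ∈ dual P := by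
  classical
  obtain ⟨S, rfl⟩ := hP
  refine ⟨∑ x ∈ S, (τ x).natAbs, fun m hm x hx => ?_⟩
  induction hx using AddSubmonoid.closure_induction with
  | mem x hx =>
    have hxP := AddSubmonoid.subset_closure hx
    simp only [LinearMap.add_apply, LinearMap.smul_apply, nsmul_eq_mul]
    by_cases h0 : σ x = 0
    · simpa [h0] using hτ x ((h.eq_zero_iff x hxP).1 h0)
    · have h1 : 1 ≤ σ x := by have := h.nonneg x hxP; omega
      have h2 := Finset.single_le_sum (f := fun x => (τ x).natAbs) (fun _ _ => Nat.zero_le _) hx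
      have h3 : (m : ℤ) * 1 ≤ m * σ x := by gcongr
      have h4 : (τ x).natAbs ≤ ∑ x ∈ S, (τ x).natAbs := h2
      omega
  | zero => simp
  | add x y _ _ hx hy => rw [map_add]; exact add_nonneg hx hy

lemma inf {E : AddSubmonoid G} {τ : Module.Dual ℤ G} (h : CutsOut P F σ) (h' : CutsOut P E τ) :
    CutsOut P (F ⊓ E) (σ + τ) where
  nonneg := add_mem h.nonneg h'.nonneg
  eq_zero_iff x hx := by
    have h1 := h.nonneg x hx
    have h2 := h'.nonneg x hx
    rw [AddSubmonoid.mem_inf, ← h.eq_zero_iff x hx, ← h'.eq_zero_iff x hx, LinearMap.add_apply]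
    constructor
    · intro h3; constructor <;> linarith
    · rintro ⟨h3, h4⟩; rw [h3, h4, add_zero]

end CutsOut
end Separation

section Charts

variable {G : Type v} [AddCommGroup G] (R : Type u) [CommRing R]

/-- The monoid algebra over `R` of the dual of `P`. -/
abbrev ChartRing (P : AddSubmonoid G) : Type (max u v) := AddMonoidAlgebra R (dual P)

/-- For `P ≤ Q`, the homomorphism of monoid algebras induced by the inclusion of duals. -/
def chartMap {P Q : AddSubmonoid G} (h : P ≤ Q) : ChartRing R Q →+* ChartRing R P :=
  AddMonoidAlgebra.mapDomainRingHom R (AddSubmonoid.inclusion (dual_anti h))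

/-- The element of the monoid algebra given by an element of the dual of `P`. -/
def monomial (P : AddSubmonoid G) : Multiplicative (dual P) →* ChartRing R P :=
  AddMonoidAlgebra.of R (dual P)

lemma chartMap_monomial {P Q : AddSubmonoid G} (h : P ≤ Q) (m : dual Q) :
    chartMap R h (monomial R Q (.ofAdd m)) =
      monomial R P (.ofAdd (AddSubmonoid.inclusion (dual_anti h) m)) := by
  simp [chartMap, monomial]

@[simp] lemma chartMap_refl (P : AddSubmonoid G) : chartMap R (le_refl P) = RingHom.id _ := by
  refine RingHom.ext fun x => ?_
  have : AddSubmonoid.inclusion (dual_anti (le_refl P)) = AddMonoidHom.id _ := rfl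
  simp [chartMap, this]

lemma chartMap_comp {P Q N : AddSubmonoid G} (h : P ≤ Q) (h' : Q ≤ N) :
    (chartMap R h).comp (chartMap R h') = chartMap R (h.trans h') := by
  refine RingHom.ext fun x => ?_
  induction x using AddMonoidAlgebra.induction_linear with
  | zero => simp
  | add x y hx hy => rw [map_add, map_add, hx, hy]
  | single m r =>
    simp only [chartMap, RingHom.comp_apply, AddMonoidAlgebra.mapDomainRingHom_apply,
      AddMonoidAlgebra.mapDomain_single]
    rfl

lemma CutsOut.isLocalization {P F : AddSubmonoid G} {σ : Module.Dual ℤ G} (h : CutsOut P F σ)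
    (hP : P.FG) (hF : F ≤ P) :
    letI := (chartMap R hF).toAlgebra
    IsLocalization.Away (monomial R P (.ofAdd ⟨σ, h.nonneg⟩)) (ChartRing R F) := by
  let := (chartMap R hF).toAlgebra
  have halg (x : ChartRing R P) : algebraMap (ChartRing R P) (ChartRing R F) x =
    chartMap R hF x := rfl
  have hpow (n : ℕ) : chartMap R hF (monomial R P (.ofAdd ⟨σ, h.nonneg⟩) ^ n) =
      AddMonoidAlgebra.single (n • ⟨σ, dual_anti hF h.nonneg⟩) 1 := by
    rw [map_pow, chartMap_monomial]
    simp [monomial, AddMonoidAlgebra.single_pow, AddSubmonoid.inclusion]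
  refine ⟨?_, ?_, ?_⟩
  · rintro ⟨_, n, rfl⟩
    rw [halg]
    simp only [map_pow]
    refine IsUnit.pow n ?_
    have := hpow 1
    rw [pow_one, one_nsmul] at this
    rw [this]
    refine IsUnit.of_mul_eq_one (AddMonoidAlgebra.single ⟨-σ, h.neg_mem hF⟩ 1) ?_
    rw [AddMonoidAlgebra.single_mul_single, AddMonoidAlgebra.one_def]
    congr 1
    · ext1
      simp
    · simp
  · suffices ∀ z : ChartRing R F, ∃ n : ℕ, ∀ m ≥ n,
        ∃ x, z * AddMonoidAlgebra.single (m • ⟨σ, dual_anti hF h.nonneg⟩) 1 = chartMap R hF x by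
      intro z
      obtain ⟨n, hn⟩ := this z
      obtain ⟨x, hx⟩ := hn n le_rfl
      exact ⟨⟨x, ⟨_, n, rfl⟩⟩, by rw [halg, halg, hpow, hx]⟩
    intro z
    induction z using AddMonoidAlgebra.induction_linear with
    | zero => exact ⟨0, fun m _ => ⟨0, by simp⟩⟩
    | add x y hx hy =>
      obtain ⟨n, hn⟩ := hx
      obtain ⟨k, hk⟩ := hy
      refine ⟨max n k, fun m hm => ?_⟩
      obtain ⟨a, ha⟩ := hn m (le_of_max_le_left hm)
      obtain ⟨b, hb⟩ := hk m (le_of_max_le_right hm)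
      exact ⟨a + b, by rw [add_mul, ha, hb, map_add]⟩
    | single τ r =>
      obtain ⟨n, hn⟩ := h.exists_add_mem hP τ τ.2
      refine ⟨n, fun m hm => ⟨AddMonoidAlgebra.single ⟨_, hn m hm⟩ r, ?_⟩⟩
      rw [AddMonoidAlgebra.single_mul_single, mul_one]
      simp only [chartMap, AddMonoidAlgebra.mapDomainRingHom_apply,
        AddMonoidAlgebra.mapDomain_single]
      rfl
  · intro x y hxy
    refine ⟨1, ?_⟩
    rw [AddMonoidAlgebra.mapDomain_injective (AddSubmonoid.inclusion_injective _) hxy]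

/-- The affine chart `U_P`, the spectrum of the monoid algebra of the dual of `P`. -/
def chart (P : AddSubmonoid G) : Scheme.{max u v} := Spec (.of (ChartRing R P))

/-- The morphism `U_P ⟶ U_Q` for `P ≤ Q`. -/
def chartIncl {P Q : AddSubmonoid G} (h : P ≤ Q) : chart R P ⟶ chart R Q :=
  Spec.map (CommRingCat.ofHom (chartMap R h))

lemma CutsOut.isOpenImmersion {P F : AddSubmonoid G} {σ : Module.Dual ℤ G} (h : CutsOut P F σ)
    (hP : P.FG) (hF : F ≤ P) : IsOpenImmersion (chartIncl R hF) := by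
  let := (chartMap R hF).toAlgebra
  have := h.isLocalization R hP hF
  exact IsOpenImmersion.of_isLocalization (monomial R P (.ofAdd ⟨σ, h.nonneg⟩))

lemma CutsOut.range {P F : AddSubmonoid G} {σ : Module.Dual ℤ G} (h : CutsOut P F σ)
    (hP : P.FG) (hF : F ≤ P) : Set.range (chartIncl R hF) =
      (PrimeSpectrum.basicOpen (monomial R P (.ofAdd ⟨σ, h.nonneg⟩)) : Set (PrimeSpectrum _)) := by
  let := (chartMap R hF).toAlgebra
  have := h.isLocalization R hP hF
  exact PrimeSpectrum.localization_away_comap_range (ChartRing R F) _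

/-- The function on an open subset of `U_P` given by an element of the dual of `P`. -/
def character (P : AddSubmonoid G) (U : (chart R P).Opens) :
    Multiplicative (dual P) →* Γ(chart R P, U) :=
  (((chart R P).presheaf.map (homOfLE le_top).op).hom.comp
    (Scheme.ΓSpecIso (.of (ChartRing R P))).inv.hom).toMonoidHom.comp (monomial R P)

lemma map_character (P : AddSubmonoid G) {U V : (chart R P).Opens} (h : V ≤ U)
    (m : Multiplicative (dual P)) :
    (chart R P).presheaf.map (homOfLE h).op (character R P U m) = character R P V m :=
  (ConcreteCategory.congr_hom ((chart R P).presheaf.map_comp (homOfLE le_top).op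
    (homOfLE h).op) ((Scheme.ΓSpecIso (.of (ChartRing R P))).inv (monomial R P m))).symm

lemma chartIncl_app_character {P Q : AddSubmonoid G} (h : P ≤ Q) (U : (chart R Q).Opens)
    (m : dual Q) : (chartIncl R h).app U (character R Q U (.ofAdd m)) =
      character R P (chartIncl R h ⁻¹ᵁ U) (.ofAdd (AddSubmonoid.inclusion (dual_anti h) m)) := by
  have h1 := ConcreteCategory.congr_hom ((chartIncl R h).naturality
    (homOfLE (le_top : U ≤ ⊤)).op) ((Scheme.ΓSpecIso (.of (ChartRing R Q))).inv
      (monomial R Q (.ofAdd m)))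
  have h2 := ConcreteCategory.congr_hom (Scheme.ΓSpecIso_inv_naturality
    (CommRingCat.ofHom (chartMap R h))) (monomial R Q (.ofAdd m))
  refine h1.trans ((congrArg ((chart R P).presheaf.map ((Opens.map (chartIncl R h).base).map
    (homOfLE (le_top : U ≤ ⊤))).op) h2.symm).trans ?_)
  exact congrArg (fun t => (chart R P).presheaf.map (homOfLE le_top).op
    ((Scheme.ΓSpecIso (.of (ChartRing R P))).inv t)) (chartMap_monomial R h m)

end Charts

namespace Fan

variable {G : Type v} [AddCommGroup G] (Δ : Fan G) (R : Type u) [CommRing R]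

/-- The charts of a fan, with the morphisms `U_P ⟶ U_Q` for `P ≤ Q` (they are open immersions). -/
def diagram : Δ.cones ⥤ Scheme.{max u v} where
  obj P := chart R P.1
  map f := chartIncl R (leOfHom f)
  map_id P := by
    change Spec.map (CommRingCat.ofHom (chartMap R _)) = _
    rw [chartMap_refl]
    exact Spec.map_id _
  map_comp f g := by
    change Spec.map (CommRingCat.ofHom (chartMap R _)) = _
    rw [← chartMap_comp R (leOfHom f) (leOfHom g), CommRingCat.ofHom_comp, Spec.map_comp]
    rfl


variable {Δ} in
lemma isFace_of_le {P Q : Δ.cones} (h : P ≤ Q) : IsFace Q.1 P.1 := by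
  have := (Δ.inter_face P.1 P.2 Q.1 Q.2).2
  rwa [inf_eq_left.2 h] at this

/-- The intersection of two cones of a fan. -/
def inf (P Q : Δ.cones) : Δ.cones :=
  ⟨P.1 ⊓ Q.1, Δ.face_mem P.1 P.2 _ (Δ.inter_face P.1 P.2 Q.1 Q.2).1⟩

variable [Module.Finite ℤ G]

instance isOpenImmersion_diagram_map {P Q : Δ.cones} (f : P ⟶ Q) :
    IsOpenImmersion ((Δ.diagram R).map f) := by
  obtain ⟨σ, hσ⟩ := (isFace_of_le (leOfHom f)).exists_cutsOut (Δ.isConvexCone Q.1 Q.2).fg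
  exact hσ.isOpenImmersion R (Δ.isConvexCone Q.1 Q.2).fg (leOfHom f)

instance isLocallyDirected_diagram : (Δ.diagram R ⋙ Scheme.forget).IsLocallyDirected := by
  constructor
  intro P Q N f g x y hxy
  have hN := (Δ.isConvexCone N.1 N.2).fg
  obtain ⟨σ, hσ⟩ := (isFace_of_le (leOfHom f)).exists_cutsOut hN
  obtain ⟨τ, hτ⟩ := (isFace_of_le (leOfHom g)).exists_cutsOut hN
  let fP : Δ.inf P Q ⟶ P := homOfLE (inf_le_left : P.1 ⊓ Q.1 ≤ P.1)
  let fQ : Δ.inf P Q ⟶ Q := homOfLE (inf_le_right : P.1 ⊓ Q.1 ≤ Q.1)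
  replace hxy : (Δ.diagram R).map f x = (Δ.diagram R).map g y := hxy
  have hx : (Δ.diagram R).map f x ∈ Set.range ((Δ.diagram R).map f) := ⟨x, rfl⟩
  have hy : (Δ.diagram R).map f x ∈ Set.range ((Δ.diagram R).map g) := ⟨y, hxy.symm⟩
  have h : (Δ.diagram R).map f x ∈ Set.range ((Δ.diagram R).map (fP ≫ f)) := by
    have h1 := (hσ.range R hN (leOfHom f)).le hx
    have h2 := (hτ.range R hN (leOfHom g)).le hy
    refine ((hσ.inf hτ).range R hN (leOfHom (fP ≫ f))).ge ?_
    have : monomial R N.1 (.ofAdd ⟨σ + τ, (hσ.inf hτ).nonneg⟩) =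
        monomial R N.1 (.ofAdd ⟨σ, hσ.nonneg⟩) * monomial R N.1 (.ofAdd ⟨τ, hτ.nonneg⟩) := by
      rw [← map_mul]; rfl
    rw [this, PrimeSpectrum.basicOpen_mul]
    exact ⟨h1, h2⟩
  obtain ⟨z, hz⟩ := h
  refine ⟨Δ.inf P Q, fP, fQ, z, ?_, ?_⟩
  · apply ((Δ.diagram R).map f).isOpenEmbedding.injective
    rw [Functor.map_comp] at hz
    exact hz
  · apply ((Δ.diagram R).map g).isOpenEmbedding.injective
    have : fP ≫ f = fQ ≫ g := Subsingleton.elim _ _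
    rw [this, Functor.map_comp] at hz
    exact hz.trans hxy

/-- The toric scheme of a fan: the gluing of the charts `U_P` along the open immersions
`U_{P ∩ Q} ⟶ U_P` and `U_{P ∩ Q} ⟶ U_Q`, that is, the colimit of the diagram of charts. -/
def toricScheme : Scheme.{max u v} := colimit (Δ.diagram R)

/-- The open immersion of the chart `U_P` into the toric scheme. -/
def ι (P : Δ.cones) : chart R P.1 ⟶ Δ.toricScheme R := colimit.ι (Δ.diagram R) P

instance (P : Δ.cones) : IsOpenImmersion (Δ.ι R P) :=
  inferInstanceAs <| IsOpenImmersion (colimit.ι (Δ.diagram R) P)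


lemma w {P Q : Δ.cones} (h : P ≤ Q) : chartIncl R h ≫ Δ.ι R Q = Δ.ι R P :=
  colimit.w (Δ.diagram R) (homOfLE h)

lemma w_apply {P Q : Δ.cones} (h : P ≤ Q) (x : chart R P.1) :
    Δ.ι R Q (chartIncl R h x) = Δ.ι R P x := by
  rw [← Δ.w R h, Scheme.Hom.comp_apply]

/-- `U_P ∩ U_Q = U_{P ∩ Q}`. -/
lemma range_inter (P Q : Δ.cones) :
    Set.range (Δ.ι R P) ∩ Set.range (Δ.ι R Q) = Set.range (Δ.ι R (Δ.inf P Q)) := by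
  ext x
  constructor
  · rintro ⟨⟨y, hy⟩, ⟨z, hz⟩⟩
    obtain ⟨N, f, g, t, ht, -⟩ := (Scheme.IsLocallyDirected.ι_eq_ι_iff (Δ.diagram R)).1
      (hy.trans hz.symm)
    have k : N ≤ Δ.inf P Q := fun x hx => ⟨leOfHom f hx, leOfHom g hx⟩
    refine ⟨chartIncl R k t, ?_⟩
    exact (Δ.w_apply R k t).trans
      ((Δ.w_apply R (leOfHom f) t).symm.trans ((congrArg (Δ.ι R P) ht).trans hy))
  · rintro ⟨y, rfl⟩
    constructor
    · exact ⟨_, Δ.w_apply R (show Δ.inf P Q ≤ P from (inf_le_left : P.1 ⊓ Q.1 ≤ P.1)) y⟩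
    · exact ⟨_, Δ.w_apply R (show Δ.inf P Q ≤ Q from (inf_le_right : P.1 ⊓ Q.1 ≤ Q.1)) y⟩

/-- `m` lies in the dual of `P`, and on `U ∩ U_P` the function `f` is the one given by `m`. -/
def IsCharacterOn (P : Δ.cones) (U : (Δ.toricScheme R).Opens) (m : Module.Dual ℤ G)
    (f : Γ(Δ.toricScheme R, U)) : Prop :=
  ∃ hm : m ∈ dual P.1, (Δ.ι R P).app U f = character R P.1 (Δ.ι R P ⁻¹ᵁ U) (.ofAdd ⟨m, hm⟩)

lemma IsCharacterOn.mono {P Q : Δ.cones} (h : P ≤ Q) {U : (Δ.toricScheme R).Opens}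
    {m : Module.Dual ℤ G} {f : Γ(Δ.toricScheme R, U)} (hf : Δ.IsCharacterOn R Q U m f) :
    Δ.IsCharacterOn R P U m f := by
  obtain ⟨hm, hf⟩ := hf
  suffices ∀ g : chart R P.1 ⟶ Δ.toricScheme R, chartIncl R h ≫ Δ.ι R Q = g →
      g.app U f = character R P.1 (g ⁻¹ᵁ U) (.ofAdd ⟨m, dual_anti h hm⟩) from
    ⟨dual_anti h hm, this _ (Δ.w R h)⟩
  rintro _ rfl
  rw [Scheme.Hom.comp_app]
  refine (congrArg ((chartIncl R h).app _) hf).trans ?_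
  exact chartIncl_app_character R h _ ⟨m, hm⟩

lemma IsCharacterOn.one (P : Δ.cones) (U : (Δ.toricScheme R).Opens) :
    Δ.IsCharacterOn R P U 0 1 :=
  ⟨zero_mem _, by rw [map_one]; exact (map_one (character R P.1 _)).symm⟩

lemma IsCharacterOn.mul {P : Δ.cones} {U : (Δ.toricScheme R).Opens}
    {m n : Module.Dual ℤ G} {f g : Γ(Δ.toricScheme R, U)} (hf : Δ.IsCharacterOn R P U m f)
    (hg : Δ.IsCharacterOn R P U n g) : Δ.IsCharacterOn R P U (m + n) (f * g) := by
  obtain ⟨hm, hf⟩ := hf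
  obtain ⟨hn, hg⟩ := hg
  refine ⟨add_mem hm hn, ?_⟩
  rw [map_mul, hf, hg, ← map_mul]
  rfl

lemma IsCharacterOn.restrict {P : Δ.cones} {U V : (Δ.toricScheme R).Opens} (h : V ≤ U)
    {m : Module.Dual ℤ G} {f : Γ(Δ.toricScheme R, U)} (hf : Δ.IsCharacterOn R P U m f) :
    Δ.IsCharacterOn R P V m ((Δ.toricScheme R).presheaf.map (homOfLE h).op f) := by
  obtain ⟨hm, hf⟩ := hf
  refine ⟨hm, ?_⟩
  have h1 := ConcreteCategory.congr_hom ((Δ.ι R P).naturality (homOfLE h).op) f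
  refine h1.trans ((congrArg ((chart R P.1).presheaf.map
    ((Opens.map (Δ.ι R P).base).map (homOfLE h)).op) hf).trans ?_)
  exact map_character R P.1 (U := Δ.ι R P ⁻¹ᵁ U) (V := Δ.ι R P ⁻¹ᵁ V) (fun x hx => h hx) _

/-- Pairs `(m, f)` such that `U` is covered by charts `U_P` with `m` in the dual of `P` on which `f` is
the function given by `m`. -/
def localCharacters (U : (Δ.toricScheme R).Opens) :
    Submonoid (Multiplicative (Module.Dual ℤ G) × Γ(Δ.toricScheme R, U)) where
  carrier := {s | ∀ x ∈ U, ∃ P, x ∈ Set.range (Δ.ι R P) ∧ Δ.IsCharacterOn R P U s.1.toAdd s.2}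
  one_mem' x _ := by
    obtain ⟨P, y, hy⟩ := Scheme.IsLocallyDirected.ι_jointly_surjective (Δ.diagram R) x
    exact ⟨P, ⟨y, hy⟩, IsCharacterOn.one Δ R P U⟩
  mul_mem' {s t} hs ht x hx := by
    obtain ⟨P, hP, hs⟩ := hs x hx
    obtain ⟨Q, hQ, ht⟩ := ht x hx
    exact ⟨Δ.inf P Q, (Δ.range_inter R P Q).le ⟨hP, hQ⟩,
      (hs.mono Δ R (inf_le_left : P.1 ⊓ Q.1 ≤ P.1)).mul Δ R
        (ht.mono Δ R (inf_le_right : P.1 ⊓ Q.1 ≤ Q.1))⟩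

/-- At a point of `U_P`, the local characters are obtained from those in the dual of `P` by inverting
characters in the dual of `P` that are invertible at the point. So on `U_P` the local characters
generate the same log structure as the dual of `P` with its map to the monoid algebra. -/
lemma exists_add_mem_dual (P : Δ.cones) {U : (Δ.toricScheme R).Opens}
    (s : Δ.localCharacters R U) (y : chart R P.1) (hy : Δ.ι R P y ∈ U) :
    ∃ σ : dual P.1, s.1.1.toAdd + σ ∈ dual P.1 ∧
      y ∈ (PrimeSpectrum.basicOpen (monomial R P.1 (.ofAdd σ)) : Set (PrimeSpectrum _)) := by
  obtain ⟨Q, hQ, hm, -⟩ := s.2 _ hy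
  obtain ⟨z, hz⟩ := (Δ.range_inter R P Q).le ⟨⟨y, rfl⟩, hQ⟩
  have hL : Δ.inf P Q ≤ P := (inf_le_left : P.1 ⊓ Q.1 ≤ P.1)
  have hfg := (Δ.isConvexCone P.1 P.2).fg
  obtain ⟨σ, hσ⟩ := (isFace_of_le hL).exists_cutsOut hfg
  obtain ⟨n, hn⟩ := hσ.exists_add_mem hfg _
    (dual_anti (inf_le_right : P.1 ⊓ Q.1 ≤ Q.1) hm)
  refine ⟨n • ⟨σ, hσ.nonneg⟩, hn n le_rfl, ?_⟩
  have hy' : chartIncl R hL z = y :=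
    (Δ.ι R P).isOpenEmbedding.injective ((Δ.w_apply R hL z).trans hz)
  have hmem := (hσ.range R hfg hL).le ⟨z, hy'⟩
  rw [ofAdd_nsmul, map_pow]
  exact fun h => hmem (Ideal.IsPrime.mem_of_pow_mem (PrimeSpectrum.isPrime _) n h)

/-- The pre-log structure that glues the homomorphisms from the dual of `P` to its monoid algebra: its
sections on `U` are the local characters, and `α` sends a local character to the function it gives. -/
def preLogStructure : PreLogStructure (Δ.toricScheme R) where
  monoid :=
    { obj := fun U => CommMonCat.of (Δ.localCharacters R U.unop)
      map := fun {U V} i => CommMonCat.ofHom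
        ((((MonoidHom.id _).prodMap ((Δ.toricScheme R).presheaf.map i).hom.toMonoidHom).comp
          (Δ.localCharacters R U.unop).subtype).codRestrict (Δ.localCharacters R V.unop)
          fun s x hx => by
            obtain ⟨P, hP, hs⟩ := s.2 x (leOfHom i.unop hx)
            exact ⟨P, hP, hs.restrict Δ R (leOfHom i.unop)⟩)
      map_id := fun U => by
        refine CommMonCat.hom_ext (MonoidHom.ext fun s => Subtype.ext (Prod.ext rfl ?_))
        exact ConcreteCategory.congr_hom ((Δ.toricScheme R).presheaf.map_id U) _
      map_comp := fun i j => by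
        refine CommMonCat.hom_ext (MonoidHom.ext fun s => Subtype.ext (Prod.ext rfl ?_))
        exact ConcreteCategory.congr_hom ((Δ.toricScheme R).presheaf.map_comp i j) _ }
  α :=
    { app := fun U => CommMonCat.ofHom ((MonoidHom.snd _ _).comp
        (Δ.localCharacters R U.unop).subtype)
      naturality := fun U V i => rfl }

/-- The log structure on the toric scheme, which on each chart `U_P` is the log structure generated by
the homomorphism from the dual of `P` to its monoid algebra. -/
def logStructure : LogStructure (Δ.toricScheme R) := (Δ.preLogStructure R).associated

end Fan
end Toric
end

-- The question is local, and at a point x it is settled on the smallest chart containing x. Choose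
-- P in the fan of minimal rank with x in U_P. If a character σ in the dual of P is nonzero at x,
-- then x already lies in the chart of the face where σ vanishes, so by minimality that face is P
-- and σ is in `perp P`. Hence every noninvertible character of U_P vanishes at x, and P is
-- contained in every cone whose chart contains x.
--
-- Up to units, every germ of the log structure at x is therefore a character of U_P. So the log
-- ideal is generated by the characters outside `perp P`. Comparing coefficients in the monoid
-- algebra shows that two characters associated at x differ by an element of `perp P`, so the group
-- in the rank condition is `Module.Dual ℤ G ⧸ perp P` (`rank_grothendieckGroup_quotient`).
--
-- The rest is algebra (`regular_and_dim_of_chart`). The dual of P splits as Q × `perp P`, where Q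
-- is sharp, finitely generated by Gordan's lemma, and of rank equal to that of the quotient above.
-- Thus R[dual P] = A[Q], where A = R[perp P] is a Laurent polynomial ring over R and so is regular.
-- The prime J of x contains all nontrivial monomials of A[Q]. Dividing by these monomials leaves A,
-- so the local ring modulo the log ideal is A localized at p = J ∩ A, which is regular.
--
-- The dimension formula becomes ht J = ht p + rank Q (`height_eq_height_comap_add_coneRank`). For
-- ≥, a chain of primes below p is extended by the primes attached to a flag of faces of Q
-- descending one rank at a time, which `exists_facet` provides. For ≤, `exists_parameters` gives at
-- most rank Q elements such that every prime containing them contains all nontrivial monomials.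
-- Krull's height theorem then bounds ht J by rank Q plus a height modulo these elements, where
-- primes are determined by their traces on A.

universe w

noncomputable section

open CategoryTheory AlgebraicGeometry TopologicalSpace Opposite Limits

namespace Toric

/-! ### Faces of a submonoid and their ranks -/

section Faces

variable {L : Type v} [AddCommGroup L]

/-- The rank of the subgroup spanned by a submonoid. -/
def coneRank (Q : AddSubmonoid L) : ℕ := Module.finrank ℤ (Submodule.span ℤ (Q : Set L))

/-- The condition says precisely that Q \ F absorbs addition from Q, so Q \ F serves as the prime
ideal. -/
lemma IsFace.of_mem_of_add_mem {Q F : AddSubmonoid L} (h : F ≤ Q)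
    (hF : ∀ x ∈ Q, ∀ y ∈ Q, x + y ∈ F → y ∈ F) : IsFace Q F := by
  have hd : (F : Set L) = (Q : Set L) \ ((Q : Set L) \ F) := by
    rw [sdiff_sdiff_right_self]
    exact (inf_eq_right.2 (show (F : Set L) ≤ Q from h)).symm
  exact ⟨(Q : Set L) \ F, ⟨Set.sdiff_subset, fun x hx y hy =>
    ⟨add_mem hx hy.1, fun h' => hy.2 (hF x hx y hy.1 h')⟩, F, hd⟩, hd⟩

lemma IsFace.of_dual {Q : AddSubmonoid L} {σ : Module.Dual ℤ L} (hσ : σ ∈ dual Q) :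
    IsFace Q (Q ⊓ AddMonoidHom.mker (σ : L →+ ℤ)) := by
  refine .of_mem_of_add_mem inf_le_left fun x hx y hy hxy => ⟨hy, ?_⟩
  have h1 := hσ x hx
  have h2 := hσ y hy
  have h3 : σ (x + y) = 0 := hxy.2
  rw [map_add] at h3
  change σ y = 0
  linarith

lemma IsFace.bot {Q : AddSubmonoid L} (h : ∀ x ∈ Q, -x ∈ Q → x = 0) : IsFace Q ⊥ := by
  refine .of_mem_of_add_mem bot_le fun x hx y hy hxy => ?_
  rw [AddSubmonoid.mem_bot] at hxy ⊢
  exact h y hy (by rwa [← eq_neg_of_add_eq_zero_left hxy])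

lemma IsFace.trans {Q F E : AddSubmonoid L} (h : IsFace Q F) (h' : IsFace F E) : IsFace Q E := by
  refine .of_mem_of_add_mem (h'.le.trans h.le) fun x hx y hy hxy => ?_
  have h1 : y ∈ F := h.mem_of_add_mem hx hy (h'.le hxy)
  have h2 : x ∈ F := h.mem_of_add_mem hy hx (by rw [add_comm]; exact h'.le hxy)
  exact h'.mem_of_add_mem h2 h1 hxy

lemma IsFace.refl (Q : AddSubmonoid L) : IsFace Q Q :=
  .of_mem_of_add_mem le_rfl fun _ _ _ hy _ => hy

/-- A face is generated by the generators that it contains. -/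
lemma IsFace.closure_eq {S : Set L} {F : AddSubmonoid L}
    (h : IsFace (AddSubmonoid.closure S) F) : AddSubmonoid.closure {x ∈ S | x ∈ F} = F := by
  refine le_antisymm (AddSubmonoid.closure_le.2 fun x hx => hx.2) fun x hx => ?_
  have key : ∀ y ∈ AddSubmonoid.closure S, y ∈ F → y ∈ AddSubmonoid.closure {x ∈ S | x ∈ F} := by
    intro y hy
    induction hy using AddSubmonoid.closure_induction with
    | mem y hy => exact fun h => AddSubmonoid.subset_closure ⟨hy, h⟩
    | zero => exact fun _ => zero_mem _
    | add y z hy hz hy' hz' =>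
      exact fun hyz => add_mem (hy' (h.mem_of_add_mem hz hy (by rwa [add_comm])))
        (hz' (h.mem_of_add_mem hy hz hyz))
  exact key x (h.le hx) hx

lemma IsFace.fg {Q F : AddSubmonoid L} (h : IsFace Q F) (hQ : Q.FG) : F.FG := by
  classical
  obtain ⟨S, rfl⟩ := hQ
  refine ⟨S.filter (· ∈ F), ?_⟩
  rw [Finset.coe_filter]
  exact h.closure_eq

lemma mem_span_iff_exists_sub (F : AddSubmonoid L) {x : L}
    (hx : x ∈ Submodule.span ℤ (F : Set L)) : ∃ a ∈ F, ∃ b ∈ F, x = a - b := by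
  rw [← Submodule.mem_toAddSubgroup, Submodule.span_int_eq_addSubgroupClosure] at hx
  induction hx using AddSubgroup.closure_induction with
  | mem x hx => exact ⟨x, hx, 0, zero_mem _, by simp⟩
  | zero => exact ⟨0, zero_mem _, 0, zero_mem _, by simp⟩
  | add x y _ _ hx hy =>
    obtain ⟨a, ha, b, hb, rfl⟩ := hx
    obtain ⟨c, hc, d, hd, rfl⟩ := hy
    exact ⟨a + c, add_mem ha hc, b + d, add_mem hb hd, by abel⟩
  | neg x _ hx =>
    obtain ⟨a, ha, b, hb, rfl⟩ := hx
    exact ⟨b, hb, a, ha, by abel⟩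

/-- For n > 0, writing n x = a - b with a, b in F gives (b + (n - 1) x) + x = a in F, and a face
contains the summands of its elements. This is why faces are detected rationally, hence by ranks. -/
lemma IsFace.mem_of_smul_mem_span {Q F : AddSubmonoid L} (h : IsFace Q F) {x : L} (hx : x ∈ Q)
    {n : ℤ} (hn : n ≠ 0) (hnx : n • x ∈ Submodule.span ℤ (F : Set L)) : x ∈ F := by
  obtain ⟨m, hm, hmx⟩ : ∃ m : ℕ, m ≠ 0 ∧ m • x ∈ Submodule.span ℤ (F : Set L) := by
    refine ⟨n.natAbs, by simpa using hn, ?_⟩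
    rcases n.natAbs_eq with h' | h'
    · rwa [h', natCast_zsmul] at hnx
    · rw [h', neg_smul, natCast_zsmul] at hnx
      simpa using neg_mem hnx
  obtain ⟨a, ha, b, hb, hab⟩ := mem_span_iff_exists_sub F hmx
  obtain ⟨k, rfl⟩ := Nat.exists_eq_succ_of_ne_zero hm
  refine h.mem_of_add_mem (x := b + k • x) (add_mem (h.le hb) (nsmul_mem hx k)) hx ?_
  rw [succ_nsmul] at hab
  rwa [add_assoc, hab, add_sub_cancel]

variable [Module.Finite ℤ L]

lemma coneRank_mono {Q Q' : AddSubmonoid L} (h : Q ≤ Q') : coneRank Q ≤ coneRank Q' :=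
  Submodule.finrank_mono (Submodule.span_mono h)

lemma exists_smul_mem_of_finrank_le {H K : Submodule ℤ L} (h : H ≤ K)
    (hr : Module.finrank ℤ K ≤ Module.finrank ℤ H) {x : L} (hx : x ∈ K) :
    ∃ n : ℤ, n ≠ 0 ∧ n • x ∈ H := by
  have h1 := Submodule.finrank_quotient_add_finrank (H.submoduleOf K)
  rw [(Submodule.submoduleOfEquivOfLe h).finrank_eq] at h1
  have h2 : Module.finrank ℤ (K ⧸ H.submoduleOf K) = 0 := by omega
  obtain ⟨n, hn, h3⟩ := Module.finrank_eq_zero_iff.1 h2 (Submodule.Quotient.mk ⟨x, hx⟩)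
  refine ⟨n, hn, ?_⟩
  rw [← Submodule.Quotient.mk_smul, Submodule.Quotient.mk_eq_zero] at h3
  exact h3

/-- Equal rank makes the span of E torsion over that of F, so a multiple of each element of E falls
in the span of F. The lemma is used as strict monotonicity of the rank on faces. -/
lemma IsFace.eq_of_coneRank_le {Q F E : AddSubmonoid L} (h : IsFace Q F) (h1 : F ≤ E)
    (h2 : E ≤ Q) (hr : coneRank E ≤ coneRank F) : F = E := by
  refine le_antisymm h1 fun x hx => ?_
  obtain ⟨n, hn, hnx⟩ := exists_smul_mem_of_finrank_le (Submodule.span_mono h1) hr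
    (Submodule.subset_span hx)
  exact h.mem_of_smul_mem_span (h2 hx) hn hnx

/-- Modulo H and then modulo torsion, x stays nonzero in a finitely generated torsion-free, hence
free, group, whose functionals separate points. -/
lemma exists_dual_ne_zero (H : Submodule ℤ L) {x : L} (hx : ∀ n : ℤ, n ≠ 0 → n • x ∉ H) :
    ∃ σ : Module.Dual ℤ L, (∀ y ∈ H, σ y = 0) ∧ σ x ≠ 0 := by
  let T := Submodule.torsion ℤ (L ⧸ H)
  let π : L →ₗ[ℤ] (L ⧸ H) ⧸ T := T.mkQ ∘ₗ H.mkQ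
  have hπ : π x ≠ 0 := by
    intro h0
    have h1 : H.mkQ x ∈ T := (Submodule.Quotient.mk_eq_zero T).1 h0
    obtain ⟨n, hn⟩ := (Submodule.mem_torsion_iff _).1 h1
    refine hx n (nonZeroDivisors.coe_ne_zero n) ?_
    rw [← Submodule.Quotient.mk_eq_zero, Submodule.Quotient.mk_smul]
    exact hn
  have hφ : ∃ φ : Module.Dual ℤ ((L ⧸ H) ⧸ T), φ (π x) ≠ 0 := by
    by_contra! hc
    exact hπ ((Module.forall_dual_apply_eq_zero_iff ℤ _).1 hc)
  obtain ⟨φ, hφ⟩ := hφ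
  refine ⟨φ ∘ₗ π, fun y hy => ?_, hφ⟩
  have : H.mkQ y = 0 := (Submodule.Quotient.mk_eq_zero H).2 hy
  simp [π, this]

/-- A sharp finitely generated monoid of positive rank has a face of corank one. -/
lemma exists_facet {Q : AddSubmonoid L} (hQ : Q.FG) (hs : ∀ x ∈ Q, -x ∈ Q → x = 0) {n : ℕ}
    (hr : coneRank Q = n + 1) : ∃ F, IsFace Q F ∧ coneRank F = n := by
  have hbot : coneRank (⊥ : AddSubmonoid L) = 0 := by
    have : Submodule.span ℤ (((⊥ : AddSubmonoid L) : Set L)) = ⊥ := by simp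
    rw [coneRank, this]
    exact finrank_bot ℤ L
  let p : ℕ → Prop := fun k => ∃ F, IsFace Q F ∧ coneRank F = k
  classical
  have hp0 : p 0 := ⟨⊥, .bot hs, hbot⟩
  have hmax := Nat.findGreatest_spec (P := p) (Nat.zero_le n) hp0
  obtain ⟨F, hF, hFr⟩ := hmax
  have hle : Nat.findGreatest p n ≤ n := Nat.findGreatest_le n
  rcases hle.lt_or_eq with hlt | heq
  swap
  · exact ⟨F, hF, hFr.trans heq⟩
  exfalso
  -- F has the largest rank that is at most n. If that rank is below n, the only face strictly above
  -- F is Q; the contradiction comes from constructing another one.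
  have hproper : ∀ E, IsFace Q E → F ≤ E → F ≠ E → E = Q := by
    intro E hE hFE hne
    have h1 : coneRank F < coneRank E := by
      by_contra h2
      exact hne (hF.eq_of_coneRank_le hFE hE.le (not_lt.1 h2))
    have h3 : coneRank E ≤ n + 1 := hr ▸ coneRank_mono hE.le
    rcases Nat.lt_or_eq_of_le h3 with h4 | h4
    · have := Nat.le_findGreatest (P := p) (Nat.lt_succ_iff.1 h4) ⟨E, hE, rfl⟩
      omega
    · exact hE.eq_of_coneRank_le hE.le le_rfl (by omega)
  obtain ⟨τ, hτ⟩ := hF.exists_cutsOut hQ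
  obtain ⟨q, hq, hqF⟩ : ∃ q ∈ Q, q ∉ F := by
    by_contra! hc
    have : F = Q := le_antisymm hF.le hc
    subst this
    omega
  -- H has rank at most rank F + 1 ≤ n, so some x in Q is independent of it. A functional ρ that
  -- vanishes on H but not at x will be tilted by τ until it supports Q.
  let H := Submodule.span ℤ (F : Set L) ⊔ Submodule.span ℤ {q}
  have hHr : Module.finrank ℤ H < coneRank Q := by
    have h1 : Module.finrank ℤ H ≤ Module.finrank ℤ (Submodule.span ℤ (F : Set L)) +
        Module.finrank ℤ (Submodule.span ℤ {q}) := by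
      have := Submodule.rank_add_le_rank_add_rank (Submodule.span ℤ (F : Set L))
        (Submodule.span ℤ {q})
      simp only [← Module.finrank_eq_rank] at this
      exact_mod_cast this
    have h2 : Module.finrank ℤ (Submodule.span ℤ {q}) ≤ 1 := by
      simpa using finrank_span_le_card (R := ℤ) ({q} : Set L)
    have h3 : coneRank F = Module.finrank ℤ (Submodule.span ℤ (F : Set L)) := rfl
    omega
  obtain ⟨x, hx, hxH⟩ : ∃ x ∈ Q, ∀ n : ℤ, n ≠ 0 → n • x ∉ H := by
    by_contra! hc
    refine hHr.not_ge ?_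
    have : ∀ y ∈ Submodule.span ℤ (Q : Set L), ∃ n : ℤ, n ≠ 0 ∧ n • y ∈ H := by
      intro y hy
      obtain ⟨a, ha, b, hb, rfl⟩ := mem_span_iff_exists_sub Q hy
      obtain ⟨k, hk, hka⟩ := hc a ha
      obtain ⟨l, hl, hlb⟩ := hc b hb
      refine ⟨k * l, mul_ne_zero hk hl, ?_⟩
      rw [smul_sub]
      refine sub_mem ?_ ?_
      · rw [mul_comm, mul_smul]
        exact H.smul_mem l hka
      · rw [mul_smul]
        exact H.smul_mem k hlb
    have hHQ : H ≤ Submodule.span ℤ (Q : Set L) := sup_le (Submodule.span_mono hF.le)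
      (Submodule.span_le.2 (Set.singleton_subset_iff.2 (Submodule.subset_span hq)))
    have h1 := Submodule.finrank_quotient_add_finrank
      (H.submoduleOf (Submodule.span ℤ (Q : Set L)))
    rw [(Submodule.submoduleOfEquivOfLe hHQ).finrank_eq] at h1
    have h2 : Module.finrank ℤ (Submodule.span ℤ (Q : Set L) ⧸
        H.submoduleOf (Submodule.span ℤ (Q : Set L))) = 0 := by
      refine Module.finrank_eq_zero_iff.2 fun z => ?_
      obtain ⟨⟨y, hy⟩, rfl⟩ := Submodule.Quotient.mk_surjective _ z
      obtain ⟨n, hn, hny⟩ := this y hy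
      refine ⟨n, hn, ?_⟩
      rw [← Submodule.Quotient.mk_smul, Submodule.Quotient.mk_eq_zero]
      exact hny
    change Module.finrank ℤ (Submodule.span ℤ (Q : Set L)) ≤ _
    omega
  obtain ⟨ρ, hρH, hρx⟩ := exists_dual_ne_zero H hxH
  have hρF : ∀ y ∈ F, ρ y = 0 := fun y hy =>
    hρH y (Submodule.mem_sup_left (Submodule.subset_span hy))
  have hρq : ρ q = 0 := hρH q (Submodule.mem_sup_right (Submodule.subset_span rfl))
  have hτpos : ∀ y ∈ Q, y ∉ F → 0 < τ y := fun y hy hyF =>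
    lt_of_le_of_ne (hτ.nonneg y hy) fun h0 => hyF ((hτ.eq_zero_iff y hy).1 h0.symm)
  obtain ⟨S, hS⟩ := hQ
  have hSQ : ∀ s ∈ S, s ∈ Q := fun s hs => hS ▸ AddSubmonoid.subset_closure hs
  have hne : (S.filter (· ∉ F)).Nonempty := by
    rw [Finset.filter_nonempty_iff]
    by_contra! hc
    refine hqF ?_
    have : AddSubmonoid.closure (S : Set L) ≤ F := AddSubmonoid.closure_le.2 hc
    exact this (hS ▸ hq)
  -- With g minimizing ρ/τ among the generators outside F, the functional τ(g) ρ - ρ(g) τ is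
  -- nonnegative on Q and vanishes on F and at g. Its zero face is strictly larger than F, hence is
  -- all of Q; evaluating at q gives ρ(g) = 0, and then evaluating at x gives ρ(x) = 0.
  obtain ⟨g, hg, hmin⟩ := Finset.exists_min_image _ (fun y => (ρ y : ℚ) / τ y) hne
  obtain ⟨hgS, hgF⟩ := Finset.mem_filter.1 hg
  have hτg := hτpos g (hSQ g hgS) hgF
  let σ : Module.Dual ℤ L := τ g • ρ - ρ g • τ
  have hσ : ∀ y, σ y = τ g * ρ y - ρ g * τ y := fun y => by simp [σ]
  have hσF : ∀ y ∈ F, σ y = 0 := fun y hy => by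
    rw [hσ, hρF y hy, (hτ.eq_zero_iff y (hF.le hy)).2 hy]; simp
  have hσQ : σ ∈ dual Q := by
    intro y hy
    rw [← hS] at hy
    induction hy using AddSubmonoid.closure_induction with
    | mem y hy =>
      by_cases hyF : y ∈ F
      · exact (hσF y hyF).ge
      · have hτy := hτpos y (hSQ y hy) hyF
        have h1 := hmin y (Finset.mem_filter.2 ⟨hy, hyF⟩)
        have hτg' : (0 : ℚ) < τ g := by exact_mod_cast hτg
        have hτy' : (0 : ℚ) < τ y := by exact_mod_cast hτy
        rw [div_le_div_iff₀ hτg' hτy'] at h1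
        have h2 : ρ g * τ y ≤ ρ y * τ g := by exact_mod_cast h1
        rw [hσ]
        linarith
    | zero => simp
    | add y z _ _ hy hz => rw [map_add]; exact add_nonneg hy hz
  have hE := IsFace.of_dual hσQ
  have hall := hproper _ hE (fun y hy => ⟨hF.le hy, hσF y hy⟩) (by
    intro h0
    refine hgF (h0.ge ⟨hSQ g hgS, ?_⟩)
    change σ g = 0
    rw [hσ]; ring)
  have hz : ∀ y ∈ Q, σ y = 0 := fun y hy => (hall.ge hy).2
  have h1 := hz q hq
  rw [hσ, hρq, mul_zero, zero_sub, neg_eq_zero] at h1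
  have h2 : ρ g = 0 := (mul_eq_zero.1 h1).resolve_right (hτpos q hq hqF).ne'
  have h3 := hz x hx
  rw [hσ, h2, zero_mul, sub_zero] at h3
  exact hρx ((mul_eq_zero.1 h3).resolve_left hτg.ne')

end Faces
end Toric

namespace Toric

/-! ### Heights of monomial primes in a monoid algebra -/

section Heights

variable {L : Type v} [AddCommGroup L] {A : Type u} [CommRing A] {Q : AddSubmonoid L}

open AddMonoidAlgebra

open Classical in
/-- The homomorphism `A[Q] → (A ⧸ I)[L]` that kills the monomials outside a face `F`. -/
def faceHom (I : Ideal A) {F : AddSubmonoid L} (hF : IsFace Q F) :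
    AddMonoidAlgebra A Q →ₐ[A] AddMonoidAlgebra (A ⧸ I) L :=
  lift A (AddMonoidAlgebra (A ⧸ I) L) Q
    { toFun := fun σ => if (σ.toAdd : L) ∈ F then single (σ.toAdd : L) 1 else 0
      map_one' := by
        rw [toAdd_one, if_pos (by simp), AddMonoidAlgebra.one_def]
        rfl
      map_mul' := fun σ τ => by
        rw [toAdd_mul, AddSubmonoid.coe_add]
        -- The cut-off is multiplicative because F is a face: a sum is in F exactly when both
        -- summands are.
        by_cases h : (σ.toAdd + τ.toAdd : L) ∈ F
        · have h1 := hF.mem_of_add_mem σ.toAdd.2 τ.toAdd.2 h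
          have h2 := hF.mem_of_add_mem τ.toAdd.2 σ.toAdd.2 (by rwa [add_comm] at h)
          rw [if_pos h, if_pos h1, if_pos h2, single_mul_single, one_mul]
        · rw [if_neg h]
          by_cases h1 : (σ.toAdd : L) ∈ F
          · rw [if_neg (c := (τ.toAdd : L) ∈ F) fun h2 => h (add_mem h1 h2), mul_zero]
          · rw [if_neg h1, zero_mul] }

open Classical in
lemma faceHom_single (I : Ideal A) {F : AddSubmonoid L} (hF : IsFace Q F) (σ : Q) (a : A) :
    faceHom I hF (single σ a) =
      if (σ : L) ∈ F then single (σ : L) (Ideal.Quotient.mk I a) else 0 := by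
  rw [faceHom, lift_single]
  change a • (if (σ : L) ∈ F then single (σ : L) (1 : A ⧸ I) else 0) = _
  split_ifs
  · rw [smul_single, Algebra.smul_def, mul_one]
    rfl
  · simp

lemma coeff_faceHom (I : Ideal A) {F : AddSubmonoid L} (hF : IsFace Q F)
    (f : AddMonoidAlgebra A Q) (σ : Q) (hσ : (σ : L) ∈ F) :
    (faceHom I hF f).coeff σ = Ideal.Quotient.mk I (f.coeff σ) := by
  classical
  induction f using AddMonoidAlgebra.induction_linear with
  | zero => simp
  | add f g hf hg => rw [map_add, coeff_add, coeff_add, Finsupp.add_apply, Finsupp.add_apply, hf, hg,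
      map_add]
  | single τ a =>
    rw [faceHom_single, coeff_single, Finsupp.single_apply]
    by_cases h : τ = σ
    · subst h
      rw [if_pos hσ, if_pos rfl, coeff_single, Finsupp.single_apply, if_pos rfl]
    · rw [if_neg h, map_zero]
      split_ifs
      · rw [coeff_single, Finsupp.single_apply, if_neg fun h' => h (Subtype.ext h')]
      · rfl

lemma coeff_faceHom_of_notMem (I : Ideal A) {F : AddSubmonoid L} (hF : IsFace Q F)
    (f : AddMonoidAlgebra A Q) {l : L} (hl : l ∉ F) : (faceHom I hF f).coeff l = 0 := by
  classical
  induction f using AddMonoidAlgebra.induction_linear with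
  | zero => simp
  | add f g hf hg => rw [map_add, coeff_add, Finsupp.add_apply, hf, hg, add_zero]
  | single τ a =>
    rw [faceHom_single]
    split_ifs with h
    · rw [coeff_single, Finsupp.single_apply, if_neg]
      rintro rfl
      exact hl h
    · rfl

/-- The ideal of the elements of `A[Q]` whose coefficients at the elements of `F` lie in `I`. -/
def faceIdeal (I : Ideal A) {F : AddSubmonoid L} (hF : IsFace Q F) : Ideal (AddMonoidAlgebra A Q) :=
  RingHom.ker (faceHom I hF)

lemma mem_faceIdeal {I : Ideal A} {F : AddSubmonoid L} {hF : IsFace Q F}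
    {f : AddMonoidAlgebra A Q} :
    f ∈ faceIdeal I hF ↔ ∀ σ : Q, (σ : L) ∈ F → f.coeff σ ∈ I := by
  rw [faceIdeal, RingHom.mem_ker]
  constructor
  · intro h σ hσ
    rw [← Ideal.Quotient.eq_zero_iff_mem, ← coeff_faceHom I hF f σ hσ, h]
    rfl
  · intro h
    ext l
    by_cases hl : l ∈ F
    · exact (coeff_faceHom I hF f ⟨l, hF.le hl⟩ hl).trans
        (Ideal.Quotient.eq_zero_iff_mem.2 (h ⟨l, hF.le hl⟩ hl))
    · exact coeff_faceHom_of_notMem I hF f hl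

/-- It is a kernel with values in (A ⧸ I)[L], which is a domain since A ⧸ I is one and L has unique
sums. -/
lemma faceIdeal_isPrime [UniqueSums L] (I : Ideal A) [I.IsPrime] {F : AddSubmonoid L}
    (hF : IsFace Q F) : (faceIdeal I hF).IsPrime :=
  RingHom.ker_isPrime _

lemma faceIdeal_lt_of_lt {I J : Ideal A} (h : I < J) {F : AddSubmonoid L} (hF : IsFace Q F) :
    faceIdeal I hF < faceIdeal J hF := by
  obtain ⟨hle, a, haJ, haI⟩ := SetLike.lt_iff_le_and_exists.1 h
  refine SetLike.lt_iff_le_and_exists.2 ⟨fun f hf => mem_faceIdeal.2 fun σ hσ =>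
    hle (mem_faceIdeal.1 hf σ hσ), single 0 a, mem_faceIdeal.2 fun σ _ => ?_, fun h' => haI ?_⟩
  · classical
    rw [coeff_single, Finsupp.single_apply]
    split_ifs
    exacts [haJ, zero_mem _]
  · have := mem_faceIdeal.1 h' 0 (zero_mem F)
    rwa [coeff_single, Finsupp.single_eq_same] at this

lemma faceIdeal_lt_of_face_lt {I : Ideal A} (hI : I ≠ ⊤) {F E : AddSubmonoid L} (hF : IsFace Q F)
    (hE : IsFace Q E) (h : E < F) : faceIdeal I hF < faceIdeal I hE := by
  obtain ⟨hle, x, hxF, hxE⟩ := SetLike.lt_iff_le_and_exists.1 h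
  refine SetLike.lt_iff_le_and_exists.2 ⟨fun f hf => mem_faceIdeal.2 fun σ hσ =>
    mem_faceIdeal.1 hf σ (hle hσ), single ⟨x, hF.le hxF⟩ 1, mem_faceIdeal.2 fun σ hσ => ?_,
    fun h' => hI ?_⟩
  · classical
    rw [coeff_single, Finsupp.single_apply, if_neg]
    · exact zero_mem _
    · rintro rfl
      exact hxE hσ
  · have := mem_faceIdeal.1 h' ⟨x, hF.le hxF⟩ hxF
    rw [coeff_single, Finsupp.single_eq_same] at this
    exact (Ideal.eq_top_iff_one I).2 this

lemma uniqueSums_of_free [Module.Free ℤ L] : UniqueSums L :=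
  have := TwoUniqueSums.of_injective_addHom (Module.Free.chooseBasis ℤ L).repr.toAddEquiv.toAddHom
    (Module.Free.chooseBasis ℤ L).repr.injective inferInstance
  inferInstance

/-- A chain of primes in A ending at I lifts to the ideals attached to the full face Q. From there
one passes to a facet, a facet of that facet, and so on down to 0; each step strictly enlarges the
prime, and there are rank Q steps. -/
lemma height_add_coneRank_le [Module.Free ℤ L] [Module.Finite ℤ L] (hQ : Q.FG)
    (hs : ∀ x ∈ Q, -x ∈ Q → x = 0) (I : Ideal A) [hI : I.IsPrime] :
    I.height + coneRank Q ≤ (faceIdeal I (IsFace.bot hs)).height := by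
  have := uniqueSums_of_free (L := L)
  have h1 : I.height ≤ (faceIdeal I (IsFace.refl Q)).height := by
    let φ : PrimeSpectrum A → PrimeSpectrum (AddMonoidAlgebra A Q) := fun J =>
      ⟨faceIdeal J.1 (IsFace.refl Q), have := J.2; faceIdeal_isPrime _ _⟩
    have hφ : StrictMono φ := fun J K h => faceIdeal_lt_of_lt (I := J.1) (J := K.1) h _
    have := Order.height_le_height_apply_of_strictMono φ hφ ⟨I, hI⟩
    rwa [← PrimeSpectrum.height_eq_orderHeight, ← PrimeSpectrum.height_eq_orderHeight] at this
  have h2 : ∀ (n : ℕ) (F : AddSubmonoid L) (hF : IsFace Q F), coneRank F = n →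
      (faceIdeal I hF).height + n ≤ (faceIdeal I (IsFace.bot hs)).height := by
    intro n
    induction n with
    | zero =>
      intro F hF _
      rw [Nat.cast_zero, add_zero]
      exact Ideal.height_mono fun f hf => mem_faceIdeal.2 fun σ hσ =>
        mem_faceIdeal.1 hf σ ((bot_le : ⊥ ≤ F) hσ)
    | succ n ih =>
      intro F hF hn
      obtain ⟨E, hE, hEr⟩ := exists_facet (hF.fg hQ) (fun x hx hx' => hs x (hF.le hx) (hF.le hx')) hn
      have hlt : E < F := lt_of_le_of_ne hE.le fun h => by
        rw [h] at hEr
        omega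
      have := faceIdeal_isPrime I hF
      have := faceIdeal_isPrime I (hF.trans hE)
      have h3 := Ideal.height_add_one_le_of_lt_of_isPrime
        (faceIdeal_lt_of_face_lt hI.ne_top hF (hF.trans hE) hlt)
      calc (faceIdeal I hF).height + (n + 1 : ℕ) = (faceIdeal I hF).height + 1 + n := by
            push_cast; ring
        _ ≤ (faceIdeal I (hF.trans hE)).height + n := by gcongr
        _ ≤ _ := ih E (hF.trans hE) hEr
  exact le_trans (by gcongr) (h2 _ Q (IsFace.refl Q) rfl)

/-- For each i from 1 to rank Q, take the sum over the faces of rank i of the monomial of an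
interior point of the face. The monomials outside a prime I form a face F. If its rank i were
positive, the i-th sum would have exactly one term outside I, the one of F, and so could not lie in
I. -/
lemma exists_parameters [Module.Free ℤ L] [Module.Finite ℤ L] (A : Type u) [CommRing A] (hQ : Q.FG)
    (hs : ∀ x ∈ Q, -x ∈ Q → x = 0) :
    ∃ θ : Set (AddMonoidAlgebra A Q), θ.encard ≤ coneRank Q ∧
      θ ⊆ Ideal.span {f : AddMonoidAlgebra A Q | ∃ σ : Q, σ ≠ 0 ∧ single σ 1 = f} ∧
      ∀ I : Ideal (AddMonoidAlgebra A Q), I.IsPrime → θ ⊆ I →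
        ∀ σ : Q, σ ≠ 0 → single σ 1 ∈ I := by
  classical
  obtain ⟨S, rfl⟩ := hQ
  set Q := AddSubmonoid.closure (S : Set L) with hQdef
  have hmem : ∀ T ∈ S.powerset, ∑ t ∈ T, t ∈ Q := fun T hT => sum_mem fun t ht =>
    AddSubmonoid.subset_closure (Finset.mem_powerset.1 hT ht)
  -- A face is encoded by the generators it contains, so that there are visibly finitely many.
  let faces (i : ℕ) : Finset (Finset L) := S.powerset.filter fun T =>
    ∃ F, IsFace Q F ∧ S.filter (· ∈ F) = T ∧ coneRank F = i
  -- The value 0 is never taken on subsets of S, by `hmem`.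
  let χ : Finset L → AddMonoidAlgebra A Q := fun T =>
    if h : ∑ t ∈ T, t ∈ Q then single ⟨_, h⟩ 1 else 0
  let θ : ℕ → AddMonoidAlgebra A Q := fun i => ∑ T ∈ faces i, χ T
  have hbot : ∀ F : AddSubmonoid L, IsFace Q F → coneRank F = 0 → F = ⊥ := fun F hF h =>
    ((IsFace.bot hs).eq_of_coneRank_le bot_le hF.le (by omega)).symm
  -- The sum of the generators of F is an interior point of F: a face containing it contains each
  -- summand, hence F.
  have hface : ∀ F E : AddSubmonoid L, IsFace Q F → IsFace Q E → ∑ t ∈ S.filter (· ∈ F), t ∈ E →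
      F ≤ E := by
    intro F E hF hE h
    have hsub : ∀ t ∈ S.filter (· ∈ F), t ∈ E := by
      intro t ht
      rw [← Finset.sum_erase_add _ _ ht] at h
      refine hE.mem_of_add_mem (sum_mem fun s hs => ?_) ?_ h
      · exact AddSubmonoid.subset_closure (Finset.mem_filter.1 (Finset.mem_of_mem_erase hs)).1
      · exact AddSubmonoid.subset_closure (Finset.mem_filter.1 ht).1
    rw [← hF.closure_eq]
    exact AddSubmonoid.closure_le.2 fun t ht => hsub t (Finset.mem_filter.2 ht)
  -- Rank 0 is left out: its only face is 0, whose monomial is 1.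
  refine ⟨Set.range fun i : Fin (coneRank Q) => θ (i + 1), ?_, ?_, ?_⟩
  · rw [← Set.image_univ]
    refine (Set.encard_image_le _ _).trans ?_
    simp
  · rintro _ ⟨i, rfl⟩
    refine sum_mem fun T hT => ?_
    obtain ⟨hTS, F, hF, rfl, hFi⟩ := Finset.mem_filter.1 hT
    have hm := hmem _ hTS
    have hχ : χ (S.filter (· ∈ F)) = single ⟨_, hm⟩ 1 := dif_pos hm
    rw [hχ]
    refine Ideal.subset_span ⟨_, fun h0 => ?_, rfl⟩
    have h0' : ∑ t ∈ S.filter (· ∈ F), t = 0 := congrArg Subtype.val h0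
    have := hface F ⊥ hF (IsFace.bot hs) (by rw [h0']; exact zero_mem _)
    rw [le_bot_iff] at this
    subst this
    have hz : coneRank (⊥ : AddSubmonoid L) = 0 := by
      have : Submodule.span ℤ (((⊥ : AddSubmonoid L) : Set L)) = ⊥ := by simp
      rw [coneRank, this]
      exact finrank_bot ℤ L
    omega
  · intro I hI hθ
    -- The exponents of the monomials outside I; primality of I makes them a submonoid, and the
    -- ideal property makes it a face.
    let F : AddSubmonoid L :=
      { carrier := {x | ∃ h : x ∈ Q, single (⟨x, h⟩ : Q) (1 : A) ∉ I}
        zero_mem' := ⟨zero_mem _, fun h => hI.ne_top ((Ideal.eq_top_iff_one I).2 h)⟩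
        add_mem' := by
          rintro x y ⟨hx, hx'⟩ ⟨hy, hy'⟩
          refine ⟨add_mem hx hy, fun h => ?_⟩
          have : single (⟨x + y, add_mem hx hy⟩ : Q) (1 : A) =
              single (⟨x, hx⟩ : Q) 1 * single (⟨y, hy⟩ : Q) 1 := by
            rw [single_mul_single, one_mul]
            rfl
          rw [this] at h
          exact (hI.mem_or_mem h).elim hx' hy' }
    have hF : IsFace Q F := .of_mem_of_add_mem (fun x hx => hx.1) fun x hx y hy hxy => by
      refine ⟨hy, fun h => hxy.2 ?_⟩
      have : single (⟨x + y, add_mem hx hy⟩ : Q) (1 : A) =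
          single (⟨x, hx⟩ : Q) 1 * single (⟨y, hy⟩ : Q) 1 := by
        rw [single_mul_single, one_mul]
        rfl
      rw [this]
      exact I.mul_mem_left _ h
    intro σ hσ
    by_contra hσI
    have hσF : (σ : L) ∈ F := ⟨σ.2, hσI⟩
    have hr : coneRank F ≠ 0 := fun h => by
      have := hbot F hF h
      rw [this, AddSubmonoid.mem_bot] at hσF
      exact hσ (Subtype.ext hσF)
    obtain ⟨i, hi⟩ := Nat.exists_eq_succ_of_ne_zero hr
    have hir : i < coneRank Q := by
      have := coneRank_mono hF.le
      omega
    have hθi : θ (i + 1) ∈ I := hθ ⟨⟨i, hir⟩, rfl⟩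
    have hTF : S.filter (· ∈ F) ∈ faces (i + 1) := Finset.mem_filter.2
      ⟨Finset.mem_powerset.2 (Finset.filter_subset _ _), F, hF, rfl, hi⟩
    have hsum : ∑ t ∈ S.filter (· ∈ F), t ∈ F := sum_mem fun t ht => (Finset.mem_filter.1 ht).2
    obtain ⟨hm, hmI⟩ := hsum
    refine hmI ?_
    have hχ : χ (S.filter (· ∈ F)) = single ⟨_, hm⟩ 1 := dif_pos hm
    rw [← hχ]
    change ∑ T ∈ faces (i + 1), χ T ∈ I at hθi
    rw [← Finset.add_sum_erase _ _ hTF] at hθi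
    refine (I.add_mem_iff_left (sum_mem fun T hT => ?_)).1 hθi
    obtain ⟨hne, hT⟩ := Finset.mem_erase.1 hT
    obtain ⟨hTS, E, hE, rfl, hEi⟩ := Finset.mem_filter.1 hT
    by_contra hχE
    have hmE := hmem _ hTS
    have hχ' : χ (S.filter (· ∈ E)) = single ⟨_, hmE⟩ 1 := dif_pos hmE
    rw [hχ'] at hχE
    -- A term of E outside I has its exponent in F, so E ≤ F; equal ranks give E = F, which was
    -- removed from the sum.
    have hEF := hface E F hE hF ⟨hmE, hχE⟩
    have := hE.eq_of_coneRank_le hEF hF.le (by omega)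
    subst this
    exact hne rfl

lemma noetherian_of_fg [IsNoetherianRing A] (hQ : Q.FG) :
    IsNoetherianRing (AddMonoidAlgebra A Q) :=
  have : AddMonoid.FG Q := (AddMonoid.fg_iff_addSubmonoid_fg Q).2 hQ
  Algebra.FiniteType.isNoetherianRing A _

/-- The difference between an element of `A[Q]` and its constant term is in the ideal generated by
the nontrivial monomials. -/
lemma sub_single_coeff_zero_mem (f : AddMonoidAlgebra A Q) :
    f - single 0 (f.coeff 0) ∈
      Ideal.span {g : AddMonoidAlgebra A Q | ∃ σ : Q, σ ≠ 0 ∧ single σ 1 = g} := by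
  classical
  induction f using AddMonoidAlgebra.induction_linear with
  | zero => simp
  | add f g hf hg =>
    rw [coeff_add, Finsupp.add_apply, single_add, add_sub_add_comm]
    exact add_mem hf hg
  | single σ a =>
    rw [coeff_single, Finsupp.single_apply]
    by_cases h : σ = 0
    · subst h
      simp
    · rw [if_neg h, single_zero, sub_zero]
      have : single σ a = single 0 a * single σ 1 := by
        rw [single_mul_single, zero_add, mul_one]
      rw [this]
      exact Ideal.mul_mem_left _ _ (Ideal.subset_span ⟨σ, h, rfl⟩)

/-- The height of a prime ideal of `A[Q]` that contains all nontrivial monomials, for a sharp finitely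
generated monoid `Q`. -/
theorem height_eq_height_comap_add_coneRank [Module.Free ℤ L] [Module.Finite ℤ L]
    [IsNoetherianRing A] (hQ : Q.FG) (hs : ∀ x ∈ Q, -x ∈ Q → x = 0)
    (J : Ideal (AddMonoidAlgebra A Q)) [J.IsPrime] (hJ : ∀ σ : Q, σ ≠ 0 → single σ 1 ∈ J) :
    J.height = (J.comap (algebraMap A (AddMonoidAlgebra A Q))).height + coneRank Q := by
  have := noetherian_of_fg (A := A) hQ
  have hspan : Ideal.span {g : AddMonoidAlgebra A Q | ∃ σ : Q, σ ≠ 0 ∧ single σ 1 = g} ≤ J :=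
    Ideal.span_le.2 fun g ⟨σ, hσ, hg⟩ => hg ▸ hJ σ hσ
  refine le_antisymm ?_ ((height_add_coneRank_le hQ hs _).trans (Ideal.height_mono fun f hf => ?_))
  · obtain ⟨θ, hθ, hθs, hθI⟩ := exists_parameters A hQ hs
    -- Krull's height theorem reduces the upper bound to the height of J modulo θ, which is to be at
    -- most that of J ∩ A.
    refine (Ideal.height_le_height_add_encard_of_subset θ (p := J) (hθs.trans hspan)).trans
      (add_le_add ?_ hθ)
    have hle : Ideal.span θ ≤ J := Ideal.span_le.2 (hθs.trans hspan)
    let q := Ideal.Quotient.mk (Ideal.span θ)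
    have hq : Function.Surjective q := Ideal.Quotient.mk_surjective
    have hcm : (J.map q).comap q = J := by
      rw [Ideal.comap_map_of_surjective q hq, sup_eq_left]
      refine le_trans (fun x hx => ?_) hle
      exact Ideal.Quotient.eq_zero_iff_mem.1 hx
    have hprime : (J.map q).IsPrime := Ideal.map_isPrime_of_surjective hq (by
      rwa [Ideal.mk_ker])
    let ψ : PrimeSpectrum (AddMonoidAlgebra A Q ⧸ Ideal.span θ) → PrimeSpectrum A :=
      PrimeSpectrum.comap (q.comp (algebraMap A (AddMonoidAlgebra A Q)))
    -- A prime containing θ contains all nontrivial monomials, so whether it contains f depends only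
    -- on the constant term of f. Contraction to A therefore loses nothing on these primes.
    have hψ : StrictMono ψ := by
      intro I K hIK
      obtain ⟨hle, x, hxK, hxI⟩ := SetLike.lt_iff_le_and_exists.1
        (show I.asIdeal < K.asIdeal from hIK)
      obtain ⟨f, rfl⟩ := hq x
      have hmem : ∀ I : PrimeSpectrum (AddMonoidAlgebra A Q ⧸ Ideal.span θ),
          q (f - single 0 (f.coeff 0)) ∈ I.asIdeal := fun I => by
        have h1 := hθI (I.asIdeal.comap q) inferInstance fun t ht => by
          have : q t = 0 := Ideal.Quotient.eq_zero_iff_mem.2 (Ideal.subset_span ht)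
          change q t ∈ I.asIdeal
          rw [this]
          exact zero_mem _
        have h2 : Ideal.span {g : AddMonoidAlgebra A Q | ∃ σ : Q, σ ≠ 0 ∧ single σ 1 = g} ≤
            I.asIdeal.comap q := Ideal.span_le.2 fun g ⟨σ, hσ, hg⟩ => hg ▸ h1 σ hσ
        exact h2 (sub_single_coeff_zero_mem f)
      have hiff : ∀ I : PrimeSpectrum (AddMonoidAlgebra A Q ⧸ Ideal.span θ),
          q f ∈ I.asIdeal ↔ f.coeff 0 ∈ (ψ I).asIdeal := fun I => by
        have := hmem I
        rw [map_sub] at this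
        exact ⟨fun h => (I.asIdeal.sub_mem_iff_right h).1 this,
          fun h => (I.asIdeal.sub_mem_iff_left h).1 this⟩
      change (ψ I).asIdeal < (ψ K).asIdeal
      refine SetLike.lt_iff_le_and_exists.2 ⟨fun a ha => hle ha, f.coeff 0, (hiff K).1 hxK,
        fun h => hxI ((hiff I).2 h)⟩
    have := Order.height_le_height_apply_of_strictMono ψ hψ ⟨J.map q, hprime⟩
    rw [← PrimeSpectrum.height_eq_orderHeight, ← PrimeSpectrum.height_eq_orderHeight] at this
    refine this.trans (le_of_eq ?_)
    change (((J.map q).comap (q.comp (algebraMap A (AddMonoidAlgebra A Q))))).height = _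
    rw [← Ideal.comap_comap, hcm]
  · have h1 := mem_faceIdeal.1 hf 0 (zero_mem _)
    have h2 := hspan (sub_single_coeff_zero_mem f)
    exact (Submodule.sub_mem_iff_left J h1).1 h2

end Heights
end Toric

/-! ### Regularity of Laurent polynomial rings -/

lemma IsRegularRing.of_isLocalization {R : Type u} [CommRing R] [IsRegularRing R] (M : Submonoid R)
    (S : Type v) [CommRing S] [Algebra R S] [IsLocalization M S] : IsRegularRing S := by
  have := IsLocalization.isNoetherianRing M S inferInstance
  refine isRegularRing_iff.2 fun p hp => ?_
  have : IsLocalization.AtPrime (Localization.AtPrime p) (p.comap (algebraMap R S)) :=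
    IsLocalization.isLocalization_isLocalization_atPrime_isLocalization M (S := S) _ p
  exact IsRegularLocalRing.of_ringEquiv (IsLocalization.algEquiv
    (p.comap (algebraMap R S)).primeCompl (Localization.AtPrime (p.comap (algebraMap R S)))
    (Localization.AtPrime p)).toRingEquiv

lemma IsRegularRing.laurentPolynomial (R : Type u) [CommRing R] [IsRegularRing R] :
    IsRegularRing (AddMonoidAlgebra R ℤ) :=
  IsRegularRing.of_isLocalization (Submonoid.powers (Polynomial.X : Polynomial R))
    (LaurentPolynomial R)

/-- Splitting off one coordinate presents the ring as Laurent polynomials in one variable over the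
previous one. -/
lemma IsRegularRing.addMonoidAlgebra_pi (n : ℕ) : ∀ (R : Type u) [CommRing R] [IsRegularRing R],
    IsRegularRing (AddMonoidAlgebra R (Fin n → ℤ)) := by
  induction n with
  | zero =>
    intro R _ _
    exact IsRegularRing.of_ringEquiv
      (AddMonoidAlgebra.uniqueAlgEquiv R (Fin 0 → ℤ)).symm.toRingEquiv
  | succ n ih =>
    intro R _ _
    have := ih R
    have := IsRegularRing.laurentPolynomial (AddMonoidAlgebra R (Fin n → ℤ))
    let e : (ℤ × (Fin n → ℤ)) ≃+ (Fin (n + 1) → ℤ) :=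
      (Fin.consLinearEquiv ℤ fun _ : Fin (n + 1) => ℤ).toAddEquiv
    exact IsRegularRing.of_ringEquiv
      ((AddMonoidAlgebra.curryRingEquiv (R := R) (M := ℤ) (N := Fin n → ℤ)).symm.trans
        (AddMonoidAlgebra.domCongr R R e).toRingEquiv)

lemma IsRegularRing.addMonoidAlgebra_free (R : Type u) [CommRing R] [IsRegularRing R] (N : Type v)
    [AddCommGroup N] [Module.Free ℤ N] [Module.Finite ℤ N] :
    IsRegularRing (AddMonoidAlgebra R N) :=
  have := IsRegularRing.addMonoidAlgebra_pi (Module.finrank ℤ N) R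
  IsRegularRing.of_ringEquiv
    (AddMonoidAlgebra.domCongr R R (Module.finBasis ℤ N).equivFun.toAddEquiv.symm).toRingEquiv

namespace Toric

/-! ### Local rings of A[Q] for a sharp monoid Q -/

section SharpCharts

variable {L : Type v} [AddCommGroup L] {A : Type u} [CommRing A] {Q : AddSubmonoid L}

open AddMonoidAlgebra

open Classical in
/-- The augmentation `A[Q] → A` that kills the nontrivial monomials, for a sharp monoid `Q`. -/
def augmentation (A : Type u) [CommRing A] (hs : ∀ x ∈ Q, -x ∈ Q → x = 0) :
    AddMonoidAlgebra A Q →ₐ[A] A :=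
  lift A A Q
    { toFun := fun σ => if σ.toAdd = 0 then 1 else 0
      map_one' := if_pos rfl
      map_mul' := fun σ τ => by
        have h : (σ * τ).toAdd = 0 → σ.toAdd = 0 := fun h => by
          have h' : (σ.toAdd + τ.toAdd : L) = 0 := congrArg Subtype.val h
          refine Subtype.ext (hs _ σ.toAdd.2 ?_)
          rw [neg_eq_of_add_eq_zero_right h']
          exact τ.toAdd.2
        by_cases h1 : σ.toAdd = 0
        · rw [toAdd_mul, h1, zero_add, if_pos rfl, one_mul]
        · rw [if_neg h1, if_neg fun h2 => h1 (h h2), zero_mul] }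

lemma augmentation_apply (hs : ∀ x ∈ Q, -x ∈ Q → x = 0) (f : AddMonoidAlgebra A Q) :
    augmentation A hs f = f.coeff 0 := by
  classical
  induction f using AddMonoidAlgebra.induction_linear with
  | zero => simp
  | add f g hf hg => rw [map_add, coeff_add, Finsupp.add_apply, hf, hg]
  | single τ a =>
    rw [augmentation, lift_single, coeff_single, Finsupp.single_apply]
    change a • (if τ = 0 then (1 : A) else 0) = _
    split_ifs <;> simp

/-- Quotients commute with localization: A[Q] modulo the nontrivial monomials is A, so O ⧸ I is A
localized at p = J ∩ A. This is regular of dimension ht p, while dim O = ht J = ht p + rank Q. -/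
theorem regular_and_dim_of_sharp [Module.Free ℤ L] [Module.Finite ℤ L] [IsRegularRing A]
    (hQ : Q.FG) (hs : ∀ x ∈ Q, -x ∈ Q → x = 0) (J : Ideal (AddMonoidAlgebra A Q)) [J.IsPrime]
    (hJ : ∀ σ : Q, σ ≠ 0 → single σ 1 ∈ J) (O : Type w) [CommRing O]
    [Algebra (AddMonoidAlgebra A Q) O] [IsLocalization.AtPrime O J] (I : Ideal O)
    (hI : I = Ideal.span {f | ∃ σ : Q, σ ≠ 0 ∧ algebraMap (AddMonoidAlgebra A Q) O (single σ 1) = f}) :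
    IsRegularLocalRing (O ⧸ I) ∧ ringKrullDim O = ringKrullDim (O ⧸ I) + (coneRank Q : ℕ∞) := by
  let p : Ideal A := J.comap (algebraMap A (AddMonoidAlgebra A Q))
  let ε : AddMonoidAlgebra A Q →+* A := (augmentation A hs : AddMonoidAlgebra A Q →+* A)
  have hε (f : AddMonoidAlgebra A Q) : ε f = f.coeff 0 := augmentation_apply hs f
  have hεs : Function.Surjective ε := fun a => ⟨single 0 a, by rw [hε, coeff_single]; simp⟩
  have hspanJ : Ideal.span {g : AddMonoidAlgebra A Q | ∃ σ : Q, σ ≠ 0 ∧ single σ 1 = g} ≤ J :=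
    Ideal.span_le.2 fun g ⟨σ, hσ, hg⟩ => hg ▸ hJ σ hσ
  -- An element and its constant term differ by an element of J, so one avoids J exactly when the
  -- other avoids p.
  have hmap : J.primeCompl.map ε = p.primeCompl := by
    ext a
    constructor
    · rintro ⟨f, hf, rfl⟩ h
      refine hf ?_
      rw [hε] at h
      exact (Submodule.sub_mem_iff_left J h).1 (hspanJ (sub_single_coeff_zero_mem f))
    · intro ha
      exact ⟨single 0 a, ha, by rw [hε, coeff_single]; simp⟩
  let : Algebra A (O ⧸ I) := (((Ideal.Quotient.mk I).comp (algebraMap (AddMonoidAlgebra A Q) O)).comp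
    (algebraMap A (AddMonoidAlgebra A Q))).toAlgebra
  have hmapI : I = (Ideal.span {g : AddMonoidAlgebra A Q | ∃ σ : Q, σ ≠ 0 ∧ single σ 1 = g}).map
      (algebraMap (AddMonoidAlgebra A Q) O) := by
    rw [hI, Ideal.map_span]
    congr 1
    ext f
    constructor
    · rintro ⟨σ, hσ, rfl⟩
      exact ⟨_, ⟨σ, hσ, rfl⟩, rfl⟩
    · rintro ⟨_, ⟨σ, hσ, rfl⟩, rfl⟩
      exact ⟨σ, hσ, rfl⟩
  have hloc : IsLocalization (J.primeCompl.map ε) (O ⧸ I) := by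
    refine IsLocalization.of_surjective J.primeCompl O ε hεs (Ideal.Quotient.mk I)
      Ideal.Quotient.mk_surjective ?_ ?_
    · refine RingHom.ext fun f => ?_
      change Ideal.Quotient.mk I (algebraMap (AddMonoidAlgebra A Q) O f) =
        Ideal.Quotient.mk I (algebraMap (AddMonoidAlgebra A Q) O (single 0 (ε f)))
      rw [Ideal.Quotient.eq, ← map_sub, hε, hmapI]
      exact Ideal.mem_map_of_mem _ (sub_single_coeff_zero_mem f)
    · rw [Ideal.mk_ker, hmapI]
      refine Ideal.map_mono (Ideal.span_le.2 ?_)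
      rintro _ ⟨σ, hσ, rfl⟩
      change ε _ = 0
      rw [hε, coeff_single, Finsupp.single_eq_of_ne hσ.symm]
  rw [hmap] at hloc
  have hloc' : IsLocalization.AtPrime (O ⧸ I) p := hloc
  constructor
  · exact IsRegularLocalRing.of_ringEquiv (IsLocalization.algEquiv p.primeCompl
      (Localization.AtPrime p) (O ⧸ I)).toRingEquiv
  · rw [IsLocalization.AtPrime.ringKrullDim_eq_height J O,
      IsLocalization.AtPrime.ringKrullDim_eq_height p (O ⧸ I),
      height_eq_height_comap_add_coneRank hQ hs J hJ]
    rfl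

end SharpCharts
end Toric

/-! ### The dual of a cone: units, splitting and Gordan's lemma -/

lemma Submodule.exists_isCompl_of_free_quotient {E : Type u} [AddCommGroup E] (N : Submodule ℤ E)
    [Module.Free ℤ (E ⧸ N)] : ∃ W : Submodule ℤ E, IsCompl N W := by
  obtain ⟨h, hh⟩ := Module.projective_lifting_property N.mkQ LinearMap.id N.mkQ_surjective
  have hN (x : E) : (LinearMap.id - h ∘ₗ N.mkQ : E →ₗ[ℤ] E) x ∈ N := by
    rw [← Submodule.Quotient.mk_eq_zero]
    change N.mkQ (x - h (N.mkQ x)) = 0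
    rw [map_sub, sub_eq_zero]
    exact (LinearMap.congr_fun hh (N.mkQ x)).symm
  refine ⟨_, LinearMap.isCompl_of_proj (f := LinearMap.codRestrict N _ hN) fun x => Subtype.ext ?_⟩
  have : N.mkQ (x : E) = 0 := (Submodule.Quotient.mk_eq_zero N).2 x.2
  simp [this]

namespace Toric

section Perp

variable {G : Type v} [AddCommGroup G]

/-- The homomorphisms `G → ℤ` that vanish on `P`. -/
def perp (P : AddSubmonoid G) : Submodule ℤ (Module.Dual ℤ G) where
  carrier := {σ | ∀ x ∈ P, σ x = 0}
  zero_mem' _ _ := rfl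
  add_mem' ha hb x hx := by rw [LinearMap.add_apply, ha x hx, hb x hx, add_zero]
  smul_mem' c σ hσ x hx := by rw [LinearMap.smul_apply, hσ x hx, smul_zero]

lemma mem_perp_iff {P : AddSubmonoid G} {σ : Module.Dual ℤ G} :
    σ ∈ perp P ↔ σ ∈ dual P ∧ -σ ∈ dual P := by
  refine ⟨fun h => ⟨fun x hx => (h x hx).ge, fun x hx => ?_⟩, fun h x hx => ?_⟩
  · rw [LinearMap.neg_apply, h x hx, neg_zero]
  · have h1 := h.1 x hx
    have h2 := h.2 x hx
    rw [LinearMap.neg_apply] at h2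
    linarith

lemma mem_dual_closure {S : Set G} {σ : Module.Dual ℤ G} (h : ∀ x ∈ S, 0 ≤ σ x) :
    σ ∈ dual (AddSubmonoid.closure S) := fun x hx => by
  induction hx using AddSubmonoid.closure_induction with
  | mem x hx => exact h x hx
  | zero => simp
  | add x y _ _ hx hy => rw [map_add]; exact add_nonneg hx hy

lemma mem_perp_closure {S : Set G} {σ : Module.Dual ℤ G} (h : ∀ x ∈ S, σ x = 0) :
    σ ∈ perp (AddSubmonoid.closure S) :=
  mem_perp_iff.2 ⟨mem_dual_closure fun x hx => (h x hx).ge, mem_dual_closure fun x hx => by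
    rw [LinearMap.neg_apply, h x hx, neg_zero]⟩

/-- Evaluation on a finite generating set S of P embeds the quotient in ℤ^S. Freeness provides the
complement W along which the dual of P splits. -/
lemma free_quotient_perp [Module.Finite ℤ G] {P : AddSubmonoid G} (hP : P.FG) :
    Module.Free ℤ (Module.Dual ℤ G ⧸ perp P) := by
  obtain ⟨S, rfl⟩ := hP
  let φ : Module.Dual ℤ G →ₗ[ℤ] (S → ℤ) := LinearMap.pi fun s => LinearMap.applyₗ (s : G)
  have hφ : LinearMap.ker φ = perp (AddSubmonoid.closure (S : Set G)) := by
    ext σ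
    rw [LinearMap.mem_ker]
    refine ⟨fun h => mem_perp_closure fun x hx => congrFun h ⟨x, hx⟩, fun h => funext fun s => ?_⟩
    exact h s (AddSubmonoid.subset_closure s.2)
  rw [← hφ]
  exact Module.Free.of_equiv φ.quotKerEquivRange.symm

/-- **Gordan's lemma** for the part of the dual of `P` in a complement of the functionals that vanish
on `P`. -/
lemma dual_inf_fg {P : AddSubmonoid G} (hP : P.FG) {W : Submodule ℤ (Module.Dual ℤ G)}
    (hW : Disjoint (perp P) W) : (dual P ⊓ W.toAddSubmonoid).FG := by
  classical
  obtain ⟨S, rfl⟩ := hP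
  have hSP : ∀ s : S, (s : G) ∈ AddSubmonoid.closure (S : Set G) := fun s =>
    AddSubmonoid.subset_closure s.2
  set P := AddSubmonoid.closure (S : Set G)
  let Q := dual P ⊓ W.toAddSubmonoid
  have hinj : ∀ σ ∈ W, ∀ τ ∈ W, (∀ s : S, σ s = τ s) → σ = τ := fun σ hσ τ hτ h => by
    rw [← sub_eq_zero]
    refine Submodule.disjoint_def.1 hW _ (mem_perp_closure fun x hx => ?_) (sub_mem hσ hτ)
    rw [LinearMap.sub_apply, h ⟨x, hx⟩, sub_self]
  let M : AddSubmonoid (S → ℕ) :=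
    { carrier := {v | ∃ σ ∈ Q, ∀ s : S, (v s : ℤ) = σ s}
      zero_mem' := ⟨0, zero_mem _, fun _ => rfl⟩
      add_mem' := fun ⟨σ, hσ, h⟩ ⟨τ, hτ, h'⟩ => ⟨σ + τ, add_mem hσ hτ, fun s => by
        rw [Pi.add_apply, Nat.cast_add, h, h', LinearMap.add_apply]⟩ }
  -- M consists of the value vectors on S of the functionals in Q. It is closed under those
  -- differences that stay in ℕ^S, because a functional nonnegative on S is in the dual of P; such
  -- submonoids of ℕ^S are finitely generated.
  have hM : M.FG := AddSubmonoid.fg_of_subtractive fun x ⟨σ, hσ, h⟩ y ⟨τ, hτ, h'⟩ => by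
    have hy : ∀ s : S, (y s : ℤ) = (τ - σ) s := fun s => by
      rw [LinearMap.sub_apply, ← h, ← h', Pi.add_apply, Nat.cast_add]
      ring
    exact ⟨τ - σ, ⟨mem_dual_closure fun x hx => by
      rw [← hy ⟨x, hx⟩]
      positivity, sub_mem (S := Submodule ℤ (Module.Dual ℤ G)) hτ.2 hσ.2⟩, hy⟩
  obtain ⟨T, hT⟩ := hM
  have hTM : ∀ v ∈ T, ∃ σ ∈ Q, ∀ s : S, (v s : ℤ) = σ s := fun v hv =>
    hT.le (AddSubmonoid.subset_closure hv)
  choose! f hfQ hf using hTM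
  refine ⟨T.image f, le_antisymm (AddSubmonoid.closure_le.2 fun σ hσ => ?_) fun σ hσ => ?_⟩
  · obtain ⟨v, hv, rfl⟩ := Finset.mem_image.1 hσ
    exact hfQ v hv
  -- Generators of M lift to generators of Q since, by `hinj`, a functional in W is determined by
  -- its values on S.
  · have key : ∀ v ∈ AddSubmonoid.closure (T : Set (S → ℕ)), ∀ σ ∈ Q, (∀ s : S, (v s : ℤ) = σ s) →
        σ ∈ AddSubmonoid.closure ((T.image f : Finset _) : Set (Module.Dual ℤ G)) := by
      intro v hv
      induction hv using AddSubmonoid.closure_induction with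
      | mem v hv =>
        intro σ hσ h
        rw [hinj σ hσ.2 (f v) (hfQ v hv).2 fun s => by rw [← h, hf v hv]]
        exact AddSubmonoid.subset_closure (Finset.mem_image_of_mem f hv)
      | zero =>
        intro σ hσ h
        rw [hinj σ hσ.2 0 (zero_mem _) fun s => by rw [← h]; rfl]
        exact zero_mem _
      | add x y hx hy hx' hy' =>
        intro σ hσ h
        obtain ⟨τ, hτ, h1⟩ := hT.le hx
        obtain ⟨ρ, hρ, h2⟩ := hT.le hy
        rw [hinj σ hσ.2 (τ + ρ) (add_mem hτ.2 hρ.2) fun s => by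
          rw [← h, Pi.add_apply, Nat.cast_add, h1, h2, LinearMap.add_apply]]
        exact add_mem (hx' τ hτ h1) (hy' ρ hρ h2)
    have hv : (fun s : S => (σ s).toNat) ∈ M :=
      ⟨σ, hσ, fun s => Int.toNat_of_nonneg (hσ.1 s (hSP s))⟩
    exact key _ (hT.ge hv) σ hσ fun s => Int.toNat_of_nonneg (hσ.1 s (hSP s))

/-- Every functional is the difference of two elements of the dual of a convex cone. -/
lemma IsConvexCone.exists_add_mem_dual [Module.Finite ℤ G] {P : AddSubmonoid G}
    (hP : IsConvexCone P) (τ : Module.Dual ℤ G) : ∃ σ ∈ dual P, τ + σ ∈ dual P := by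
  obtain ⟨σ, hσ⟩ := (IsFace.bot hP.sharp).exists_cutsOut hP.fg
  obtain ⟨n, hn⟩ := hσ.exists_add_mem hP.fg τ fun x hx => by
    rw [AddSubmonoid.mem_bot.1 hx, map_zero]
  exact ⟨n • σ, nsmul_mem hσ.nonneg n, hn n le_rfl⟩

/-- The dual of `P` is the product of its units and a sharp monoid. -/
def dualSplitting {P : AddSubmonoid G} {W : Submodule ℤ (Module.Dual ℤ G)}
    (hW : IsCompl (perp P) W) :
    ((dual P ⊓ W.toAddSubmonoid : AddSubmonoid (Module.Dual ℤ G)) × perp P) ≃+ dual P where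
  toFun x := ⟨x.1 + x.2, add_mem x.1.2.1 (mem_perp_iff.1 x.2.2).1⟩
  invFun σ :=
    (⟨((Submodule.prodEquivOfIsCompl _ _ hW).symm σ).2, by
      have h := (Submodule.prodEquivOfIsCompl _ _ hW).apply_symm_apply (σ : Module.Dual ℤ G)
      rw [Submodule.coe_prodEquivOfIsCompl'] at h
      refine ⟨?_, Subtype.prop _⟩
      rw [← eq_sub_iff_add_eq'] at h
      rw [h, sub_eq_add_neg]
      exact add_mem σ.2 (mem_perp_iff.1 (Subtype.prop _)).2⟩,
      ((Submodule.prodEquivOfIsCompl _ _ hW).symm σ).1)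
  left_inv x := by
    have h : (Submodule.prodEquivOfIsCompl _ _ hW).symm ((x.1 : Module.Dual ℤ G) + x.2) =
        (x.2, ⟨x.1, x.1.2.2⟩) := by
      rw [LinearEquiv.symm_apply_eq, Submodule.coe_prodEquivOfIsCompl', add_comm]
    refine Prod.ext (Subtype.ext ?_) (Subtype.ext ?_)
    · exact congrArg (fun t => (t.2 : Module.Dual ℤ G)) h
    · exact congrArg (fun t => (t.1 : Module.Dual ℤ G)) h
  right_inv σ := by
    have h := (Submodule.prodEquivOfIsCompl _ _ hW).apply_symm_apply (σ : Module.Dual ℤ G)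
    rw [Submodule.coe_prodEquivOfIsCompl', add_comm] at h
    exact Subtype.ext h
  map_add' x y := Subtype.ext (add_add_add_comm _ _ _ _)

/-- The sharp part spans W. Given τ in W, sharpness of P yields σ in the dual with τ + σ in the
dual; if a is the W-component of σ, then τ = (τ + a) - a is a difference of elements of the sharp
part. -/
lemma coneRank_dual_inf [Module.Finite ℤ G] {P : AddSubmonoid G} (hP : IsConvexCone P)
    {W : Submodule ℤ (Module.Dual ℤ G)} (hW : IsCompl (perp P) W) :
    coneRank (dual P ⊓ W.toAddSubmonoid) = Module.finrank ℤ (Module.Dual ℤ G ⧸ perp P) := by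
  have hspan : Submodule.span ℤ
      ((dual P ⊓ W.toAddSubmonoid : AddSubmonoid (Module.Dual ℤ G)) : Set (Module.Dual ℤ G)) = W := by
    refine le_antisymm (Submodule.span_le.2 fun σ hσ => hσ.2) fun τ hτ => ?_
    obtain ⟨σ, hσ, hτσ⟩ := hP.exists_add_mem_dual τ
    obtain ⟨⟨a, b⟩, hab⟩ := (dualSplitting hW).surjective ⟨σ, hσ⟩
    have hab' : (a + b : Module.Dual ℤ G) = σ := congrArg Subtype.val hab
    have h1 : τ + a ∈ dual P := by
      have : τ + a = (τ + σ) + -b := by rw [← hab']; abel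
      rw [this]
      exact add_mem hτσ (mem_perp_iff.1 b.2).2
    have h2 : τ = (τ + a) - a := by abel
    rw [h2]
    exact sub_mem (Submodule.subset_span ⟨h1, add_mem hτ a.2.2⟩) (Submodule.subset_span a.2)
  rw [coneRank, hspan]
  exact (Submodule.quotientEquivOfIsCompl _ _ hW).finrank_eq.symm

end Perp

/-! ### Local rings of the charts -/

section Charts

variable {G : Type v} [AddCommGroup G] [Module.Free ℤ G] [Module.Finite ℤ G]
  (R : Type u) [CommRing R] [IsRegularRing R]

open AddMonoidAlgebra in
/-- The local ring of a chart at a point where every noninvertible character vanishes. -/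
theorem regular_and_dim_of_chart {P : AddSubmonoid G} (hP : IsConvexCone P)
    (J : Ideal (ChartRing R P)) [J.IsPrime]
    (hJ : ∀ σ : dual P, (σ : Module.Dual ℤ G) ∉ perp P → monomial R P (.ofAdd σ) ∈ J)
    (O : Type w) [CommRing O] [Algebra (ChartRing R P) O] [IsLocalization.AtPrime O J] (I : Ideal O)
    (hI : I = Ideal.span {f | ∃ σ : dual P, (σ : Module.Dual ℤ G) ∉ perp P ∧
      algebraMap (ChartRing R P) O (monomial R P (.ofAdd σ)) = f}) :
    IsRegularLocalRing (O ⧸ I) ∧ ringKrullDim O = ringKrullDim (O ⧸ I) +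
      (Module.finrank ℤ (Module.Dual ℤ G ⧸ perp P) : ℕ∞) := by
  have := free_quotient_perp hP.fg
  obtain ⟨W, hW⟩ := (perp P).exists_isCompl_of_free_quotient
  let Q := dual P ⊓ W.toAddSubmonoid
  have hQs : ∀ x ∈ Q, -x ∈ Q → x = 0 := fun x hx hx' =>
    Submodule.disjoint_def.1 hW.disjoint x (mem_perp_iff.2 ⟨hx.1, hx'.1⟩) hx.2
  have := IsRegularRing.addMonoidAlgebra_free R (perp P)
  -- The invertible characters are moved into the coefficient ring, leaving the algebra of the sharp
  -- monoid Q over a regular ring.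
  let e : ChartRing R P ≃+* AddMonoidAlgebra (AddMonoidAlgebra R (perp P)) Q :=
    (AddMonoidAlgebra.domCongr R R (dualSplitting hW).symm).toRingEquiv.trans
      AddMonoidAlgebra.curryRingEquiv
  have he (a : Q) (b : perp P) : e.symm (single a (single b 1)) =
      monomial R P (.ofAdd (dualSplitting hW (a, b))) := by
    rw [RingEquiv.symm_apply_eq]
    change _ = AddMonoidAlgebra.curryRingEquiv
      (AddMonoidAlgebra.domCongr R R (dualSplitting hW).symm (single (dualSplitting hW (a, b)) 1))
    rw [AddMonoidAlgebra.domCongr_single, AddEquiv.symm_apply_apply,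
      AddMonoidAlgebra.curryRingEquiv_single]
  have hperp (a : Q) (b : perp P) :
      ((dualSplitting hW (a, b) : dual P) : Module.Dual ℤ G) ∉ perp P ↔ a ≠ 0 := by
    rw [not_iff_not]
    change (a + b : Module.Dual ℤ G) ∈ perp P ↔ _
    rw [(perp P).add_mem_iff_left b.2]
    refine ⟨fun h => Subtype.ext (Submodule.disjoint_def.1 hW.disjoint _ h a.2.2), ?_⟩
    rintro rfl
    exact zero_mem _
  let : Algebra (AddMonoidAlgebra (AddMonoidAlgebra R (perp P)) Q) O :=
    ((algebraMap (ChartRing R P) O).comp e.symm.toRingHom).toAlgebra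
  let J' : Ideal (AddMonoidAlgebra (AddMonoidAlgebra R (perp P)) Q) := J.comap e.symm
  have hmap : J.primeCompl.map e = J'.primeCompl := by
    ext x
    constructor
    · rintro ⟨y, hy, rfl⟩ h
      refine hy ?_
      have h' : e.symm (e y) ∈ J := h
      rwa [RingEquiv.symm_apply_apply] at h'
    · exact fun h => ⟨e.symm x, h, e.apply_symm_apply x⟩
  have hloc : IsLocalization (J.primeCompl.map e) O :=
    IsLocalization.isLocalization_of_base_ringEquiv J.primeCompl O e
  rw [hmap] at hloc
  have hloc' : IsLocalization.AtPrime O J' := hloc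
  have halg (x : AddMonoidAlgebra (AddMonoidAlgebra R (perp P)) Q) :
    algebraMap _ O x = algebraMap (ChartRing R P) O (e.symm x) := rfl
  rw [← coneRank_dual_inf hP hW]
  refine regular_and_dim_of_sharp (dual_inf_fg hP.fg hW.disjoint) hQs J' (fun σ hσ => ?_) O I ?_
  · change e.symm _ ∈ J
    rw [AddMonoidAlgebra.one_def, he]
    exact hJ _ ((hperp σ 0).2 hσ)
  · rw [hI]
    refine le_antisymm (Ideal.span_le.2 ?_) (Ideal.span_le.2 ?_)
    · rintro _ ⟨σ, hσ, rfl⟩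
      obtain ⟨⟨a, b⟩, rfl⟩ := (dualSplitting hW).surjective σ
      rw [← he]
      -- The `perp` component contributes only a coefficient, so characters with b = 0 generate the
      -- ideal.
      have : (single a (single b 1) : AddMonoidAlgebra (AddMonoidAlgebra R (perp P)) Q) =
          single 0 (single b 1) * single a 1 := by
        rw [single_mul_single, zero_add, mul_one]
      rw [this, map_mul, map_mul]
      exact Ideal.mul_mem_left _ _ (Ideal.subset_span ⟨a, (hperp a b).1 hσ, rfl⟩)
    · rintro _ ⟨σ, hσ, rfl⟩
      rw [halg, AddMonoidAlgebra.one_def, he]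
      exact Ideal.subset_span ⟨_, (hperp σ 0).2 hσ, rfl⟩

end Charts
end Toric

namespace Toric

/-! ### Characters associated at a point -/

section Characters

variable {G : Type v} [AddCommGroup G] {R : Type u} [CommRing R] {P : AddSubmonoid G}

open AddMonoidAlgebra

lemma isUnit_monomial (σ : dual P) (hσ : (σ : Module.Dual ℤ G) ∈ perp P) :
    IsUnit (monomial R P (.ofAdd σ)) := by
  refine IsUnit.of_mul_eq_one (monomial R P (.ofAdd ⟨-σ, (mem_perp_iff.1 hσ).2⟩)) ?_
  rw [← map_mul, ← ofAdd_add]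
  have : σ + ⟨-σ, (mem_perp_iff.1 hσ).2⟩ = 0 := Subtype.ext (add_neg_cancel (σ : Module.Dual ℤ G))
  rw [this, ofAdd_zero, map_one]

/-- An element supported entirely off `perp P` is a combination of monomials that lie in J. -/
lemma exists_perp_mem_support {J : Ideal (ChartRing R P)}
    (hJ : ∀ σ : dual P, (σ : Module.Dual ℤ G) ∉ perp P → monomial R P (.ofAdd σ) ∈ J)
    {f : ChartRing R P} (hf : f ∉ J) : ∃ σ : dual P, (σ : Module.Dual ℤ G) ∈ perp P ∧
      f.coeff σ ≠ 0 := by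
  by_contra! hc
  refine hf ?_
  rw [← sum_coeff_single f]
  refine sum_mem fun σ hσ => ?_
  have hσ' : (σ : Module.Dual ℤ G) ∉ perp P := fun h => Finsupp.mem_support_iff.1 hσ (hc σ h)
  have : single σ (f.coeff σ) = single 0 (f.coeff σ) * monomial R P (.ofAdd σ) := by
    change _ = single 0 _ * single σ 1
    rw [single_mul_single, zero_add, mul_one]
  rw [this]
  exact J.mul_mem_left _ (hJ σ hσ')

/-- Take ρ in `perp P` in the support of f. The coefficient at ρ + σ of the left side is nonzero, so
the right side gives ρ + σ = a + τ with a in the dual; then σ - τ = a - ρ, and -ρ is in the dual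
too. -/
lemma sub_mem_dual_of_mul_eq {J : Ideal (ChartRing R P)}
    (hJ : ∀ σ : dual P, (σ : Module.Dual ℤ G) ∉ perp P → monomial R P (.ofAdd σ) ∈ J)
    {f g : ChartRing R P} (hf : f ∉ J) {σ τ : dual P}
    (h : f * monomial R P (.ofAdd σ) = g * monomial R P (.ofAdd τ)) :
    (σ - τ : Module.Dual ℤ G) ∈ dual P := by
  classical
  obtain ⟨ρ, hρ, hρf⟩ := exists_perp_mem_support hJ hf
  have h1 : (f * monomial R P (.ofAdd σ)).coeff (ρ + σ) = f.coeff ρ := by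
    change (f * single σ 1).coeff (ρ + σ) = _
    rw [coeff_mul_single_add, mul_one]
  have h2 : (g * monomial R P (.ofAdd τ)).coeff (ρ + σ) ≠ 0 := by rwa [← h, h1]
  obtain ⟨a, ha⟩ : ∃ a : dual P, a + τ = ρ + σ := by
    by_contra! hc
    refine h2 ?_
    change (g * single τ 1).coeff (ρ + σ) = 0
    exact coeff_mul_single_of_forall_add_ne _ _ hc
  have ha' : (a + τ : Module.Dual ℤ G) = ρ + σ := congrArg Subtype.val ha
  have : (σ - τ : Module.Dual ℤ G) = a + -ρ := by
    rw [sub_eq_iff_eq_add, add_right_comm, ha']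
    abel
  rw [this]
  exact add_mem a.2 (mem_perp_iff.1 hρ).2

/-- Characters that are associated at a point where every noninvertible character vanishes differ by
an invertible character. -/
lemma sub_mem_perp_of_mul_eq {J : Ideal (ChartRing R P)} [J.IsPrime]
    (hJ : ∀ σ : dual P, (σ : Module.Dual ℤ G) ∉ perp P → monomial R P (.ofAdd σ) ∈ J)
    {O : Type w} [CommRing O] [Algebra (ChartRing R P) O] [IsLocalization.AtPrime O J]
    {σ τ : dual P} {a b : O} (ha : IsUnit a) (hb : IsUnit b)
    (h : a * algebraMap (ChartRing R P) O (monomial R P (.ofAdd σ)) =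
      b * algebraMap (ChartRing R P) O (monomial R P (.ofAdd τ))) :
    (σ - τ : Module.Dual ℤ G) ∈ perp P := by
  obtain ⟨⟨f, s⟩, hfs⟩ := IsLocalization.surj J.primeCompl a
  obtain ⟨⟨g, t⟩, hgt⟩ := IsLocalization.surj J.primeCompl b
  have hunit : ∀ (f : ChartRing R P), IsUnit (algebraMap _ O f) → f ∉ J := fun f hf =>
    (IsLocalization.AtPrime.isUnit_to_map_iff O J f).1 hf
  have hs := IsLocalization.map_units O s
  have ht := IsLocalization.map_units O t
  have hf : f ∉ J := hunit f (hfs ▸ ha.mul hs)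
  have hg : g ∉ J := hunit g (hgt ▸ hb.mul ht)
  -- Denominators are cleared, giving an equation in the chart ring after multiplication by some c
  -- outside J; it is then used in both directions.
  have h1 : algebraMap (ChartRing R P) O (f * t * monomial R P (.ofAdd σ)) =
      algebraMap (ChartRing R P) O (g * s * monomial R P (.ofAdd τ)) := by
    simp only [map_mul, ← hfs, ← hgt]
    linear_combination (algebraMap (ChartRing R P) O s * algebraMap (ChartRing R P) O t) * h
  obtain ⟨c, hc⟩ := (IsLocalization.eq_iff_exists J.primeCompl O).1 h1
  have hc' : c * (f * t) * monomial R P (.ofAdd σ) = c * (g * s) * monomial R P (.ofAdd τ) :=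
    (mul_assoc _ _ _).trans (hc.trans (mul_assoc _ _ _).symm)
  have hmem {x y : ChartRing R P} (hx : x ∉ J) (hy : y ∉ J) : x * y ∉ J := fun h =>
    (Ideal.IsPrime.mem_or_mem ‹J.IsPrime› h).elim hx hy
  refine mem_perp_iff.2 ⟨sub_mem_dual_of_mul_eq hJ (hmem c.2 (hmem hf t.2)) hc', ?_⟩
  rw [neg_sub]
  exact sub_mem_dual_of_mul_eq hJ (hmem c.2 (hmem hg s.2)) hc'.symm

end Characters

/-! ### The rank of the characteristic group -/

section Rank

/-- The rank of the quotient of the Grothendieck group of a monoid by its subgroup of units, if up to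
units the monoid is generated by characters. -/
lemma rank_grothendieckGroup_quotient {D : Type v} [AddCommGroup D] [Module.Finite ℤ D]
    (Q : AddSubmonoid D) (hQ : ∀ d : D, ∃ q ∈ Q, d + q ∈ Q) (N : Submodule ℤ D)
    (hNQ : ∀ n ∈ N, n ∈ Q) {M : Type w} [CommMonoid M] (U : Submonoid M)
    (c : Multiplicative Q →* M) (hc : ∀ n : Q, (n : D) ∈ N → c (.ofAdd n) ∈ U)
    (hgen : ∀ s : M, ∃ u ∈ U, ∃ q : Q, s = u * c (.ofAdd q))
    (hinj : ∀ u ∈ U, ∀ u' ∈ U, ∀ q q' : Q, u * c (.ofAdd q) = u' * c (.ofAdd q') →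
      (q - q' : D) ∈ N) :
    Cardinal.toENat (Module.rank ℤ (Additive (Algebra.GrothendieckGroup M ⧸
      Subgroup.closure (Algebra.GrothendieckGroup.of '' (U : Set M))))) =
        Module.finrank ℤ (D ⧸ N) := by
  choose u hu q hq using hgen
  -- The exponent modulo N does not depend on the chosen decomposition, so it defines a homomorphism
  -- from M to D ⧸ N.
  have hclass : ∀ s : M, ∀ v ∈ U, ∀ r : Q, s = v * c (.ofAdd r) →
      N.mkQ (q s : D) = N.mkQ (r : D) := fun s v hv r h => by
    rw [← sub_eq_zero, ← map_sub]
    exact (Submodule.Quotient.mk_eq_zero N).2 (hinj _ (hu s) v hv _ _ ((hq s).symm.trans h))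
  let ρ : M →* Multiplicative (D ⧸ N) :=
    { toFun := fun s => .ofAdd (N.mkQ (q s : D))
      map_one' := by
        rw [hclass 1 1 (one_mem U) 0 (by rw [ofAdd_zero, map_one, one_mul])]
        exact congrArg _ (map_zero N.mkQ)
      map_mul' := fun s t => by
        rw [hclass (s * t) (u s * u t) (mul_mem (hu s) (hu t)) (q s + q t) (by
          rw [ofAdd_add, map_mul, mul_mul_mul_comm, ← hq, ← hq]), AddSubmonoid.coe_add, map_add,
          ofAdd_add] }
  have hρ : ∀ s : M, ∀ v ∈ U, ∀ r : Q, s = v * c (.ofAdd r) → ρ s = .ofAdd (N.mkQ (r : D)) :=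
    fun s v hv r h => congrArg Multiplicative.ofAdd (hclass s v hv r h)
  have hρU : ∀ s ∈ U, ρ s = 1 := fun s hs => by
    rw [hρ s s hs 0 (by rw [ofAdd_zero, map_one, mul_one])]
    exact congrArg _ (map_zero N.mkQ)
  let Φ : Algebra.GrothendieckGroup M →* Multiplicative (D ⧸ N) := Algebra.GrothendieckGroup.lift ρ
  have hΦ (s : M) : Φ (Algebra.GrothendieckGroup.of s) = ρ s :=
    DFunLike.congr_fun (Algebra.GrothendieckGroup.lift.symm_apply_apply ρ) s
  have hmk : ∀ z : Algebra.GrothendieckGroup M, ∃ s t : M,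
      z = Algebra.GrothendieckGroup.of s / Algebra.GrothendieckGroup.of t := fun z => by
    obtain ⟨⟨s, t⟩, hst⟩ := (Localization.monoidOf (⊤ : Submonoid M)).surj z
    exact ⟨s, t, eq_div_of_mul_eq' hst⟩
  have hsurj : Function.Surjective Φ := fun d => by
    obtain ⟨d, rfl⟩ := Multiplicative.ofAdd.surjective d
    obtain ⟨d, rfl⟩ := N.mkQ_surjective d
    obtain ⟨r, hr, hdr⟩ := hQ d
    have h1 (r : Q) : ρ (c (.ofAdd r)) = .ofAdd (N.mkQ (r : D)) :=
      hρ _ 1 (one_mem U) r (one_mul _).symm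
    refine ⟨Algebra.GrothendieckGroup.of (c (.ofAdd ⟨_, hdr⟩)) /
      Algebra.GrothendieckGroup.of (c (.ofAdd ⟨r, hr⟩)), ?_⟩
    rw [map_div, hΦ, hΦ, h1, h1, ← ofAdd_sub, ← map_sub, add_sub_cancel_right]
  have hker : Φ.ker = Subgroup.closure (Algebra.GrothendieckGroup.of '' (U : Set M)) := by
    refine le_antisymm (fun z hz => ?_) ((Subgroup.closure_le _).2 ?_)
    · obtain ⟨s, t, rfl⟩ := hmk z
      rw [MonoidHom.mem_ker, map_div, hΦ, hΦ, div_eq_one] at hz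
      have h1 : (q s - q t : D) ∈ N := by
        rw [← Submodule.Quotient.mk_eq_zero]
        change N.mkQ _ = 0
        rw [map_sub, sub_eq_zero]
        exact Multiplicative.ofAdd.injective hz
      let n : Q := ⟨_, hNQ _ h1⟩
      have h2 : q s = q t + n := Subtype.ext (add_sub_cancel (q t : D) (q s : D)).symm
      -- If the exponents of s and t differ by n in N, then s / t = (u s * c n) / u t in the
      -- Grothendieck group, a quotient of two elements of U.
      have h3 : s * u t = u s * c (.ofAdd n) * t := by
        conv_lhs => rw [hq s, h2, ofAdd_add, map_mul]
        conv_rhs => rw [hq t]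
        simp only [mul_comm, mul_left_comm]
      have h4 : (Algebra.GrothendieckGroup.of s / Algebra.GrothendieckGroup.of t :
          Algebra.GrothendieckGroup M) = Algebra.GrothendieckGroup.of (u s * c (.ofAdd n)) /
            Algebra.GrothendieckGroup.of (u t) := by
        rw [div_eq_div_iff_mul_eq_mul, ← map_mul, ← map_mul, h3]
      rw [h4]
      exact div_mem (Subgroup.subset_closure ⟨_, mul_mem (hu s) (hc n h1), rfl⟩)
        (Subgroup.subset_closure ⟨_, hu t, rfl⟩)
    · rintro _ ⟨s, hs, rfl⟩
      rw [SetLike.mem_coe, MonoidHom.mem_ker, hΦ, hρU s hs]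
  rw [← hker]
  let e : Additive (Algebra.GrothendieckGroup M ⧸ Φ.ker) ≃ₗ[ℤ] (D ⧸ N) :=
    (MulEquiv.toAdditive (QuotientGroup.quotientKerEquivOfSurjective Φ hsurj)).toIntLinearEquiv
  have : Module.Finite ℤ (Additive (Algebra.GrothendieckGroup M ⧸ Φ.ker)) :=
    Module.Finite.equiv e.symm
  rw [← Module.finrank_eq_rank, e.finrank_eq, map_natCast]

end Rank
end Toric

/-! ### Germs of an associated log structure -/

namespace PreLogStructure

variable {X : Scheme.{u}} (L : PreLogStructure X)

/-- The section of the associated log structure given by a unit and a section of `L`. -/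
def toAssociated (U : X.Opens) :
    Γ(X, U)ˣ × L.monoid.obj (op U) →* L.associated.monoid.obj (op U) :=
  ((toSheafify (Opens.grothendieckTopology X) L.pushout.monoid).app (op U)).hom.comp
    (LogPushout.mk (L.sectionsHom U))

lemma sectionsHom_toAssociated (U : X.Opens) (u : Γ(X, U)ˣ) (m : L.monoid.obj (op U)) :
    L.associated.sectionsHom U (L.toAssociated U (u, m)) = u * L.sectionsHom U m := by
  have := congrArg (fun t => t.app (op U)) (toSheafify_sheafifyLift
    (Opens.grothendieckTopology X) L.pushout.α (isSheaf_multiplicative X))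
  exact ConcreteCategory.congr_hom this (LogPushout.mk (L.sectionsHom U) (u, m))

lemma map_toAssociated {U V : X.Opens} (h : V ≤ U) (u : Γ(X, U)ˣ) (m : L.monoid.obj (op U)) :
    L.associated.monoid.map (homOfLE h).op (L.toAssociated U (u, m)) =
      L.toAssociated V (Units.map (X.presheaf.map (homOfLE h).op).hom u,
        L.monoid.map (homOfLE h).op m) :=
  (ConcreteCategory.congr_hom ((toSheafify (Opens.grothendieckTopology X) L.pushout.monoid).naturality
    (homOfLE h).op) (LogPushout.mk (L.sectionsHom U) (u, m))).symm

/-- Sections of a sheafification come locally from the presheaf, here the pushout, whose elements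
are classes of pairs. -/
lemma exists_germ_toAssociated (x : X) (s : L.associated.monoid.stalk x) :
    ∃ (V : X.Opens) (hx : x ∈ V) (u : Γ(X, V)ˣ) (m : L.monoid.obj (op V)),
      L.associated.monoid.germ V x hx (L.toAssociated V (u, m)) = s := by
  obtain ⟨U, hxU, t, rfl⟩ := TopCat.Presheaf.exists_germ_eq L.associated.monoid s
  obtain ⟨V, i, ⟨q, hq⟩, hxV⟩ := Presheaf.imageSieve_mem (Opens.grothendieckTopology X)
    (toSheafify (Opens.grothendieckTopology X) L.pushout.monoid) t x hxU
  obtain ⟨⟨v, p⟩, rfl⟩ := LogPushout.mk_surjective _ q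
  refine ⟨V, hxV, v, p, ?_⟩
  refine (congrArg (L.associated.monoid.germ V x hxV) hq).trans ?_
  exact TopCat.Presheaf.germ_res_apply L.associated.monoid i x hxV t

end PreLogStructure

/-! ### Points, minimal charts and local characters -/

namespace Toric

section Charts

variable {G : Type v} [AddCommGroup G] (R : Type u) [CommRing R]

variable {R} in
/-- The prime ideal of a point of a chart. -/
def pointIdeal {P : AddSubmonoid G} (y : chart R P) : Ideal (ChartRing R P) :=
  PrimeSpectrum.asIdeal (R := ChartRing R P) y

instance {P : AddSubmonoid G} (y : chart R P) : (pointIdeal y).IsPrime :=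
  PrimeSpectrum.isPrime (R := ChartRing R P) y

instance (P : AddSubmonoid G) (y : chart R P) :
    Algebra (ChartRing R P) ((chart R P).presheaf.stalk y) :=
  StructureSheaf.stalkAlgebra (ChartRing R P) y

instance (P : AddSubmonoid G) (y : chart R P) :
    IsLocalization.AtPrime ((chart R P).presheaf.stalk y) (pointIdeal y) :=
  StructureSheaf.IsLocalization.to_stalk (ChartRing R P) y

lemma germ_character (P : AddSubmonoid G) (U : (chart R P).Opens) (y : chart R P) (hy : y ∈ U)
    (m : Multiplicative (dual P)) : (chart R P).presheaf.germ U y hy (character R P U m) =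
      algebraMap (ChartRing R P) _ (monomial R P m) :=
  TopCat.Presheaf.germ_res_apply (chart R P).presheaf (homOfLE le_top) y hy _

end Charts

namespace Fan

variable {G : Type v} [AddCommGroup G] [Module.Finite ℤ G] (Δ : Fan G) (R : Type u) [CommRing R]

/-- Every point of the toric scheme lies in a smallest chart, where all noninvertible characters
vanish at the point. -/
lemma exists_minimal_chart (x : Δ.toricScheme R) : ∃ (P : Δ.cones) (y : chart R P.1),
    Δ.ι R P y = x ∧ (∀ Q : Δ.cones, x ∈ Set.range (Δ.ι R Q) → P ≤ Q) ∧
    ∀ σ : dual P.1, (σ : Module.Dual ℤ G) ∉ perp P.1 →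
      monomial R P.1 (.ofAdd σ) ∈ pointIdeal y := by
  classical
  have hex : ∃ n, ∃ P : Δ.cones, x ∈ Set.range (Δ.ι R P) ∧ coneRank P.1 = n := by
    obtain ⟨P, y, hy⟩ := Scheme.IsLocallyDirected.ι_jointly_surjective (Δ.diagram R) x
    exact ⟨_, P, ⟨y, hy⟩, rfl⟩
  obtain ⟨P, ⟨y, hy⟩, hP⟩ := Nat.find_spec hex
  -- P has least rank among the cones whose charts contain x, and proper faces have smaller rank.
  have hmin : ∀ F : Δ.cones, F ≤ P → x ∈ Set.range (Δ.ι R F) → F.1 = P.1 := fun F hF hx =>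
    (isFace_of_le hF).eq_of_coneRank_le hF le_rfl (by
      rw [hP]
      exact Nat.find_min' hex ⟨F, hx, rfl⟩)
  refine ⟨P, y, hy, fun Q hQ => ?_, fun σ hσ => ?_⟩
  · have h1 : (Δ.inf P Q).1 = P.1 := hmin _ (inf_le_left : P.1 ⊓ Q.1 ≤ P.1)
      ((Δ.range_inter R P Q).le ⟨⟨y, hy⟩, hQ⟩)
    exact inf_eq_left.1 h1
  · by_contra hσy
    have hcone := Δ.isConvexCone P.1 P.2
    have hface := IsFace.of_dual σ.2
    let F : Δ.cones := ⟨_, Δ.face_mem P.1 P.2 _ hface⟩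
    -- The locus in U_P where σ is invertible is the chart of the face F on which σ vanishes. It
    -- contains the point, so F = P and σ vanishes on P.
    have hcut : CutsOut P.1 F.1 σ := ⟨σ.2, fun z hz => ⟨fun h => ⟨hz, h⟩, fun h => h.2⟩⟩
    obtain ⟨z, hz⟩ := (hcut.range R hcone.fg hface.le).ge hσy
    have h1 := hmin F hface.le ⟨z, by
      rw [← Δ.w_apply R (Q := P) hface.le z]
      exact (congrArg (Δ.ι R P) hz).trans hy⟩
    exact hσ fun z hz => (h1.ge hz).2

variable {Δ R} in
-- On an open subset of U_P, restriction to the chart is an isomorphism on functions, so the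
-- exponent determines the function.
lemma IsCharacterOn.eq {P : Δ.cones} {U : (Δ.toricScheme R).Opens} (hU : U ≤ (Δ.ι R P).opensRange)
    {m : Module.Dual ℤ G} {f g : Γ(Δ.toricScheme R, U)} (hf : Δ.IsCharacterOn R P U m f)
    (hg : Δ.IsCharacterOn R P U m g) : f = g := by
  obtain ⟨hm, hf⟩ := hf
  obtain ⟨_, hg⟩ := hg
  have := (Δ.ι R P).isIso_app U hU
  exact ((ConcreteCategory.bijective_of_isIso ((Δ.ι R P).app U)).1 (hf.trans hg.symm))

/-- The function on `U_P` given by an element of the dual of `P`. -/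
def chartFunction (P : Δ.cones) :
    Multiplicative (dual P.1) →* Γ(Δ.toricScheme R, (Δ.ι R P).opensRange) :=
  have := (Δ.ι R P).isIso_app _ le_rfl
  (inv ((Δ.ι R P).app (Δ.ι R P).opensRange)).hom.toMonoidHom.comp (character R P.1 _)

lemma isCharacterOn_chartFunction (P : Δ.cones) (m : Multiplicative (dual P.1)) :
    Δ.IsCharacterOn R P _ (m.toAdd : dual P.1) (Δ.chartFunction R P m) := by
  have := (Δ.ι R P).isIso_app _ le_rfl
  refine ⟨m.toAdd.2, ?_⟩
  exact ConcreteCategory.congr_hom (IsIso.inv_hom_id ((Δ.ι R P).app (Δ.ι R P).opensRange))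
    (character R P.1 _ m)

/-- The local characters on `U_P` given by the dual of `P`. -/
def chartCharacters (P : Δ.cones) :
    Multiplicative (dual P.1) →* Δ.localCharacters R (Δ.ι R P).opensRange :=
  ((AddMonoidHom.toMultiplicative (dual P.1).subtype).prod (Δ.chartFunction R P)).codRestrict _
    fun m _ hx => ⟨P, hx, Δ.isCharacterOn_chartFunction R P m⟩

end Fan
end Toric

namespace Toric
namespace Fan

variable {G : Type v} [AddCommGroup G] [Module.Finite ℤ G] (Δ : Fan G) (R : Type u) [CommRing R]

/-! ### Stalks of the toric log structure -/

section Stalks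

variable (P : Δ.cones) (y : chart R P.1)

/-- The local ring of the toric scheme at a point of a chart. -/
def stalkEquiv : (Δ.toricScheme R).presheaf.stalk (Δ.ι R P y) ≃+* (chart R P.1).presheaf.stalk y :=
  (asIso ((Δ.ι R P).stalkMap y)).commRingCatIsoToRingEquiv

lemma stalkEquiv_germ (U : (Δ.toricScheme R).Opens) (hy : Δ.ι R P y ∈ U)
    (f : Γ(Δ.toricScheme R, U)) : Δ.stalkEquiv R P y ((Δ.toricScheme R).presheaf.germ U _ hy f) =
      (chart R P.1).presheaf.germ (Δ.ι R P ⁻¹ᵁ U) y hy ((Δ.ι R P).app U f) :=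
  (Δ.ι R P).germ_stalkMap_apply U y hy f

/-- The germs of the log structure given by the dual of `P`. -/
def characterGerm :
    Multiplicative (dual P.1) →* (Δ.logStructure R).monoid.stalk (Δ.ι R P y) :=
  ((Δ.logStructure R).monoid.germ (Δ.ι R P).opensRange _ ⟨y, rfl⟩).hom.comp
    (((Δ.preLogStructure R).toAssociated _).comp
      ((MonoidHom.inr _ _).comp (Δ.chartCharacters R P)))

/-- This turns statements about germs of the log structure into statements about monomials in a
localization of the chart ring. -/
lemma stalkEquiv_characterGerm (m : Multiplicative (dual P.1)) :
    Δ.stalkEquiv R P y ((Δ.logStructure R).stalkHom _ (Δ.characterGerm R P y m)) =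
      algebraMap (ChartRing R P.1) _ (monomial R P.1 m) := by
  have h1 : (Δ.logStructure R).stalkHom _ (Δ.characterGerm R P y m) =
      (Δ.toricScheme R).presheaf.germ (Δ.ι R P).opensRange (Δ.ι R P y) ⟨y, rfl⟩
        (Δ.chartFunction R P m) := by
    refine ((Δ.logStructure R).stalkHom_germ _ _ _ _).trans (congrArg _ ?_)
    refine ((Δ.preLogStructure R).sectionsHom_toAssociated _ 1 (Δ.chartCharacters R P m)).trans ?_
    rw [Units.val_one, one_mul]
    rfl
  obtain ⟨hm, h⟩ := Δ.isCharacterOn_chartFunction R P m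
  exact (congrArg (Δ.stalkEquiv R P y) h1).trans <| (Δ.stalkEquiv_germ R P y _ _ _).trans <|
    (congrArg ((chart R P.1).presheaf.germ _ y _) h).trans (germ_character R P.1 _ y _ _)

/-- On the smallest chart containing a point, every germ of the log structure is up to units given by
the dual of the cone. -/
lemma exists_eq_mul_characterGerm (hP : ∀ Q : Δ.cones, Δ.ι R P y ∈ Set.range (Δ.ι R Q) → P ≤ Q)
    (s : (Δ.logStructure R).monoid.stalk (Δ.ι R P y)) :
    ∃ w, IsUnit ((Δ.logStructure R).stalkHom _ w) ∧
      ∃ σ : dual P.1, s = w * Δ.characterGerm R P y (.ofAdd σ) := by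
  obtain ⟨V, hxV, u, m, rfl⟩ := (Δ.preLogStructure R).exists_germ_toAssociated _ s
  obtain ⟨Q, hQ, hm⟩ := m.2 _ hxV
  -- The local character is only known to be a character on some chart U_Q through the point;
  -- minimality of P allows restriction to U_P.
  have hmP := hm.mono Δ R (hP Q hQ)
  obtain ⟨hσ, -⟩ := id hmP
  refine ⟨(Δ.logStructure R).monoid.germ V _ hxV ((Δ.preLogStructure R).toAssociated V (u, 1)), ?_,
    ⟨_, hσ⟩, ?_⟩
  · refine (congrArg IsUnit ((Δ.logStructure R).stalkHom_germ _ V hxV _)).mpr ?_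
    refine IsUnit.map ((Δ.toricScheme R).presheaf.germ V _ hxV).hom ?_
    have h := (Δ.preLogStructure R).sectionsHom_toAssociated V u 1
    rw [map_one, mul_one] at h
    exact (congrArg IsUnit h).mpr u.isUnit
  · let U := (Δ.ι R P).opensRange
    let W := V ⊓ U
    have hxW : Δ.ι R P y ∈ W := ⟨hxV, y, rfl⟩
    have h1 : (Δ.preLogStructure R).toAssociated V (u, m) =
        (Δ.preLogStructure R).toAssociated V (u, 1) *
          (Δ.preLogStructure R).toAssociated V (1, m) := by
      rw [← map_mul, Prod.mk_mul_mk, mul_one, one_mul]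
    -- On V ∩ U_P the two local characters have the same exponent, hence give the same function.
    have h2 : (Δ.preLogStructure R).monoid.map (homOfLE (inf_le_left : W ≤ V)).op m =
        (Δ.preLogStructure R).monoid.map (homOfLE (inf_le_right : W ≤ U)).op
          (Δ.chartCharacters R P (.ofAdd ⟨_, hσ⟩)) := by
      refine Subtype.ext (Prod.ext rfl ?_)
      refine IsCharacterOn.eq (P := P) (m := m.1.1.toAdd) inf_le_right (hmP.restrict Δ R _) ?_
      exact (Δ.isCharacterOn_chartFunction R P (.ofAdd ⟨_, hσ⟩)).restrict Δ R _
    have h3 : (Δ.logStructure R).monoid.map (homOfLE (inf_le_left : W ≤ V)).op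
          ((Δ.preLogStructure R).toAssociated V (1, m)) =
        (Δ.logStructure R).monoid.map (homOfLE (inf_le_right : W ≤ U)).op
          ((Δ.preLogStructure R).toAssociated U (1, Δ.chartCharacters R P (.ofAdd ⟨_, hσ⟩))) := by
      refine ((Δ.preLogStructure R).map_toAssociated inf_le_left _ _).trans
        (Eq.trans ?_ ((Δ.preLogStructure R).map_toAssociated inf_le_right _ _).symm)
      rw [map_one, map_one, h2]
    have h4 : (Δ.logStructure R).monoid.germ V _ hxV
          ((Δ.preLogStructure R).toAssociated V (1, m)) =
        Δ.characterGerm R P y (.ofAdd ⟨_, hσ⟩) := by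
      refine (TopCat.Presheaf.germ_res_apply (Δ.logStructure R).monoid
        (homOfLE (inf_le_left : W ≤ V)) _ hxW _).symm.trans ((congrArg _ h3).trans ?_)
      exact TopCat.Presheaf.germ_res_apply (Δ.logStructure R).monoid
        (homOfLE (inf_le_right : W ≤ U)) _ hxW _
    rw [← h4]
    refine (congrArg ((Δ.logStructure R).monoid.germ V _ hxV) h1).trans ?_
    exact map_mul ((Δ.logStructure R).monoid.germ V _ hxV).hom _ _

end Stalks

end Fan
end Toric

end

/-! ### Logarithmic regularity at a point of its minimal chart -/

theorem mainTheorem5 {R : Type u} [CommRing R] [IsRegularRing R]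
    {G : Type v} [AddCommGroup G] [Module.Free ℤ G] [Module.Finite ℤ G] (Δ : Toric.Fan G) :
    (Δ.logStructure R).IsLogRegular := by
  intro x
  obtain ⟨P, y, rfl, hP, hJ⟩ := Δ.exists_minimal_chart R x
  have hcone := Δ.isConvexCone P.1 P.2
  let X := Δ.toricScheme R
  let L := Δ.logStructure R
  let O := X.presheaf.stalk (Δ.ι R P y)
  let e : O ≃+* (Toric.chart R P.1).presheaf.stalk y := Δ.stalkEquiv R P y
  -- The local ring of the toric scheme is regarded as the localization of the chart ring at the
  -- point, so that the algebraic results apply to it directly.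
  let : Algebra (Toric.ChartRing R P.1) O := (e.symm.toRingHom.comp (algebraMap _ _)).toAlgebra
  let e' : (Toric.chart R P.1).presheaf.stalk y ≃ₐ[Toric.ChartRing R P.1] O :=
    AlgEquiv.ofRingEquiv (f := e.symm) fun _ => rfl
  have : IsLocalization.AtPrime O (Toric.pointIdeal y) :=
    IsLocalization.isLocalization_of_algEquiv _ e'
  have hc (σ : Toric.dual P.1) : L.stalkHom _ (Δ.characterGerm R P y (.ofAdd σ)) =
      algebraMap (Toric.ChartRing R P.1) O (Toric.monomial R P.1 (.ofAdd σ)) := by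
    refine (e.symm_apply_apply _).symm.trans (congrArg e.symm ?_)
    exact Δ.stalkEquiv_characterGerm R P y (.ofAdd σ)
  have hunit (σ : Toric.dual P.1) : IsUnit (L.stalkHom _ (Δ.characterGerm R P y (.ofAdd σ))) ↔
      (σ : Module.Dual ℤ G) ∈ Toric.perp P.1 := by
    rw [hc, IsLocalization.AtPrime.isUnit_to_map_iff O (Toric.pointIdeal y)]
    refine ⟨fun h => by_contra fun h' => h (hJ σ h'), fun h h' => ?_⟩
    exact (Ideal.IsPrime.ne_top inferInstance)
      (Ideal.eq_top_of_isUnit_mem _ h' (Toric.isUnit_monomial σ h))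
  have hideal : L.logIdeal (Δ.ι R P y) =
      Ideal.span {f | ∃ σ : Toric.dual P.1, (σ : Module.Dual ℤ G) ∉ Toric.perp P.1 ∧
        algebraMap (Toric.ChartRing R P.1) O (Toric.monomial R P.1 (.ofAdd σ)) = f} := by
    refine le_antisymm (Ideal.span_le.2 ?_) (Ideal.span_le.2 ?_)
    · rintro _ ⟨s, hs, rfl⟩
      obtain ⟨w, hw, σ, rfl⟩ := Δ.exists_eq_mul_characterGerm R P y hP s
      rw [map_mul] at hs ⊢
      -- If σ were in `perp`, its germ would be a unit, and so would the product with w, contrary to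
      -- the choice of the germ.
      refine Ideal.mul_mem_left _ _ (Ideal.subset_span ⟨σ, fun h => hs ?_, (hc σ).symm⟩)
      exact hw.mul ((hunit σ).2 h)
    · rintro _ ⟨σ, hσ, rfl⟩
      exact Ideal.subset_span ⟨_, fun h => hσ ((hunit σ).1 h), hc σ⟩
  have hrank : L.logRank (Δ.ι R P y) =
      Module.finrank ℤ (Module.Dual ℤ G ⧸ Toric.perp P.1) := by
    refine Toric.rank_grothendieckGroup_quotient (Toric.dual P.1)
      hcone.exists_add_mem_dual (Toric.perp P.1) (fun n hn => (Toric.mem_perp_iff.1 hn).1)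
      -- The germs sent to units of O: the image of this submonoid generates `unitSubgroup`.
      ((IsUnit.submonoid O).comap (L.stalkHom _)) (Δ.characterGerm R P y)
      (fun n hn => (hunit n).2 hn) (Δ.exists_eq_mul_characterGerm R P y hP) ?_
    intro u hu u' hu' q q' h
    refine Toric.sub_mem_perp_of_mul_eq hJ (O := O) hu hu' ?_
    rw [← hc, ← hc, ← map_mul, ← map_mul, h]
  obtain ⟨h1, h2⟩ := Toric.regular_and_dim_of_chart R hcone (Toric.pointIdeal y) hJ O
    (L.logIdeal (Δ.ι R P y)) hideal
  exact ⟨h1, by rw [hrank]; exact h2⟩
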